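/- Let $D\subset\mathbb R^2$ be the closed unit disk and let $\mathrm{Homeo}(D,\partial D)$ be the group of homeomorphisms of $D$ that fix every point of $\partial D$. Consider the following homeomorphisms of the plane: $$\alpha(x,y)=(x+\tfrac1{12},y),\quad \beta(x,y)=(x,y+\tfrac1{12}),\quad \gamma(x,y)=(x,y+\tfrac1{168}\gamma_0(x)),\quad \delta(x,y)=(\delta_0(x),y),$$ where $\gamma_0:\mathbb R\to\mathbb R$ is the $1$-periodic function with $\gamma_0(x)=-4x+1$ on $[0,\tfrac12)$ and $\gamma_0(x)=4x-3$ on $[\tfrac12,1)$, and $\delta_0:\mathbb R\to\mathbb R$ is the increasing homeomorphism with $\delta_0(x+\tfrac12)=\delta_0^{-1}(x)+\tfrac12$ for all $x$, $\delta_0(x)=\tfrac12x$ on $[0,\tfrac13)$ and $\delta_0(x)=2x-\tfrac12$ on $[\tfrac13,\tfrac12)$. Let also $\bar\gamma=\eta\gamma\eta$ and $\bar\delta=\eta\delta\eta$, where $\eta(x,y)=(y,x)$. These six homeomorphisms have bounded displacement; identifying $\mathbb R^2$ with the interior of $D$ by $w\mapsto w/\sqrt{1+\|w\|^2}$ and extending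 by the identity on $\partial D$, we regard them as elements of $\mathrm{Homeo}(D,\partial D)$. Then each of $\alpha,\beta,\gamma,\delta,\bar\gamma,\bar\delta$ has a square root in $\mathrm{Homeo}(D,\partial D)$, that is, an element whose square is the given one. Moreover, for every choice of one square root in $\mathrm{Homeo}(D,\partial D)$ of each of these six elements, the finitely generated subgroup $\widetilde G\le\mathrm{Homeo}(D,\partial D)$ generated by the six square roots does not embed into the group $\mathrm{Homeo}(\mathbb S^1)$ of all homeomorphisms of the circle (preserving orientation or not): there is no injective group homomorphism $\widetilde G\to\mathrm{Homeo}(\mathbb S^1)$. -/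

import Mathlib

/-- The Euclidean plane. -/
abbrev Plane : Type := EuclideanSpace ℝ (Fin 2)

/-- The closed unit disk `D` of the plane. -/
abbrev Disk : Type := Metric.closedBall (0 : Plane) 1

/-- The group `Homeo(D, ∂D)` of the homeomorphisms of the closed unit disk that fix every point of
the boundary circle, as a subgroup of the group of all homeomorphisms of the disk. -/
def homeoDiskRelBoundary : Subgroup (Disk ≃ₜ Disk) where
  carrier := {h | ∀ z : Disk, ‖(z : Plane)‖ = 1 → h z = z}
  one_mem' := fun _ _ => rfl
  mul_mem' := by
    intro f g hf hg z hz
    change f (g z) = z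
    rw [hg z hz, hf z hz]
  inv_mem' := by
    intro f hf z hz
    change f.symm z = z
    rw [Homeomorph.symm_apply_eq, hf z hz]

/-! ### The planar homeomorphisms -/

/-- The horizontal translation `a^t (x, y) = (x + t, y)`. -/
noncomputable def translateX (t : ℝ) : Plane ≃ₜ Plane where
  toFun w := !₂[w 0 + t, w 1]
  invFun w := !₂[w 0 - t, w 1]
  left_inv w := by ext i; fin_cases i <;> simp
  right_inv w := by ext i; fin_cases i <;> simp
  continuous_toFun := by
    refine (PiLp.continuous_toLp 2 _).comp (continuous_pi fun i => ?_)
    fin_cases i <;> simp <;> fun_prop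
  continuous_invFun := by
    refine (PiLp.continuous_toLp 2 _).comp (continuous_pi fun i => ?_)
    fin_cases i <;> simp <;> fun_prop

/-- The vertical translation `b^t (x, y) = (x, y + t)`. -/
noncomputable def translateY (t : ℝ) : Plane ≃ₜ Plane where
  toFun w := !₂[w 0, w 1 + t]
  invFun w := !₂[w 0, w 1 - t]
  left_inv w := by ext i; fin_cases i <;> simp
  right_inv w := by ext i; fin_cases i <;> simp
  continuous_toFun := by
    refine (PiLp.continuous_toLp 2 _).comp (continuous_pi fun i => ?_)
    fin_cases i <;> simp <;> fun_prop
  continuous_invFun := by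
    refine (PiLp.continuous_toLp 2 _).comp (continuous_pi fun i => ?_)
    fin_cases i <;> simp <;> fun_prop

/-- The restriction of `gamma0` to the period `[0, 1)`. -/
noncomputable def gamma0Period (x : ℝ) : ℝ := if x < 1 / 2 then -4 * x + 1 else 4 * x - 3

/-- The `1`-periodic function equal to `-4x + 1` on `[0, 1/2)` and to `4x - 3` on `[1/2, 1)`. -/
noncomputable def gamma0 (x : ℝ) : ℝ := gamma0Period (Int.fract x)

theorem continuous_gamma0 : Continuous gamma0 := by
  have h : Continuous gamma0Period := by
    unfold gamma0Period
    refine (by fun_prop : Continuous fun u : ℝ => |4 * u - 2| - 1).congr fun u => ?_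
    split_ifs with hu
    · rw [abs_of_nonpos (by linarith)]; ring
    · rw [abs_of_nonneg (by linarith)]; ring
  exact ContinuousOn.comp_fract'' (f := gamma0Period) h.continuousOn
    (by norm_num [gamma0Period])

theorem abs_gamma0_le (x : ℝ) : |gamma0 x| ≤ 1 := by
  have h0 := Int.fract_nonneg x
  have h1 := Int.fract_lt_one x
  rw [gamma0, gamma0Period, abs_le]
  split_ifs <;> constructor <;> linarith

/-- The vertical shear `c^t (x, y) = (x, y + t γ₀(x))`. -/
noncomputable def shear (t : ℝ) : Plane ≃ₜ Plane where
  toFun w := !₂[w 0, w 1 + t * gamma0 (w 0)]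
  invFun w := !₂[w 0, w 1 - t * gamma0 (w 0)]
  left_inv w := by ext i; fin_cases i <;> simp
  right_inv w := by ext i; fin_cases i <;> simp
  continuous_toFun := by
    have := continuous_gamma0
    refine (PiLp.continuous_toLp 2 _).comp (continuous_pi fun i => ?_)
    fin_cases i <;> simp <;> fun_prop
  continuous_invFun := by
    have := continuous_gamma0
    refine (PiLp.continuous_toLp 2 _).comp (continuous_pi fun i => ?_)
    fin_cases i <;> simp <;> fun_prop

/-- The map `delta0` on the period `[0, 1)`. The values on `[1/2, 1)` are forced by the values on
`[0, 1/2)` and the rule `δ₀(x + 1/2) = δ₀⁻¹(x) + 1/2` (see `delta0_add_half`). -/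
noncomputable def delta0Period (x : ℝ) : ℝ :=
  if x < 1 / 3 then x / 2 else if x < 2 / 3 then 2 * x - 1 / 2 else x / 2 + 1 / 2

/-- The inverse of `delta0Period` on `[0, 1)`. -/
noncomputable def delta0InvPeriod (x : ℝ) : ℝ :=
  if x < 1 / 6 then 2 * x else if x < 5 / 6 then x / 2 + 1 / 4 else 2 * x - 1

theorem floor_add_of_mem {n : ℤ} {u : ℝ} (h0 : 0 ≤ u) (h1 : u < 1) :
    ⌊(n : ℝ) + u⌋ = n ∧ Int.fract ((n : ℝ) + u) = u := by
  constructor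
  · rw [Int.floor_eq_iff]; constructor <;> linarith
  · rw [Int.fract_intCast_add, Int.fract_eq_self]; exact ⟨h0, h1⟩

/-- The increasing homeomorphism `δ₀` of the line that commutes with `x ↦ x + 1`, is `x / 2` on
`[0, 1/3)` and `2x - 1/2` on `[1/3, 1/2)`, and satisfies `δ₀(x + 1/2) = δ₀⁻¹(x) + 1/2`. -/
noncomputable def delta0 : ℝ ≃ₜ ℝ where
  toFun x := ⌊x⌋ + delta0Period (Int.fract x)
  invFun x := ⌊x⌋ + delta0InvPeriod (Int.fract x)
  left_inv x := by
    have h0 := Int.fract_nonneg x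
    have h1 := Int.fract_lt_one x
    have hx := Int.floor_add_fract x
    have := floor_add_of_mem (n := ⌊x⌋) (u := delta0Period (Int.fract x))
      (by unfold delta0Period; split_ifs <;> linarith)
      (by unfold delta0Period; split_ifs <;> linarith)
    dsimp only
    rw [this.1, this.2]
    unfold delta0Period delta0InvPeriod
    split_ifs <;> linarith
  right_inv x := by
    have h0 := Int.fract_nonneg x
    have h1 := Int.fract_lt_one x
    have hx := Int.floor_add_fract x
    have := floor_add_of_mem (n := ⌊x⌋) (u := delta0InvPeriod (Int.fract x))
      (by unfold delta0InvPeriod; split_ifs <;> linarith)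
      (by unfold delta0InvPeriod; split_ifs <;> linarith)
    dsimp only
    rw [this.1, this.2]
    unfold delta0Period delta0InvPeriod
    split_ifs <;> linarith
  continuous_toFun := by
    have h : Continuous fun u : ℝ => max (u / 2) (min (2 * u - 1 / 2) (u / 2 + 1 / 2)) - u := by
      fun_prop
    refine (continuous_id.add (ContinuousOn.comp_fract'' h.continuousOn (by norm_num))).congr ?_
    intro x
    have h0 := Int.fract_nonneg x
    have h1 := Int.fract_lt_one x
    have hx := Int.floor_add_fract x
    change x + (max (Int.fract x / 2) (min (2 * Int.fract x - 1 / 2) (Int.fract x / 2 + 1 / 2))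
      - Int.fract x) = ⌊x⌋ + delta0Period (Int.fract x)
    unfold delta0Period
    split_ifs <;> grind
  continuous_invFun := by
    have h : Continuous fun u : ℝ => min (2 * u) (max (u / 2 + 1 / 4) (2 * u - 1)) - u := by
      fun_prop
    refine (continuous_id.add (ContinuousOn.comp_fract'' h.continuousOn (by norm_num))).congr ?_
    intro x
    have h0 := Int.fract_nonneg x
    have h1 := Int.fract_lt_one x
    have hx := Int.floor_add_fract x
    change x + (min (2 * Int.fract x) (max (Int.fract x / 2 + 1 / 4) (2 * Int.fract x - 1))
      - Int.fract x) = ⌊x⌋ + delta0InvPeriod (Int.fract x)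
    unfold delta0InvPeriod
    split_ifs <;> grind

theorem delta0_of_lt_third {x : ℝ} (h0 : 0 ≤ x) (h1 : x < 1 / 3) : delta0 x = x / 2 := by
  have hf := floor_add_of_mem (n := 0) h0 (by linarith : x < 1)
  simp only [Int.cast_zero, zero_add] at hf
  change ((⌊x⌋ : ℤ) : ℝ) + delta0Period (Int.fract x) = _
  rw [hf.1, hf.2, delta0Period, if_pos h1]
  simp

theorem delta0_of_lt_half {x : ℝ} (h0 : 1 / 3 ≤ x) (h1 : x < 1 / 2) :
    delta0 x = 2 * x - 1 / 2 := by
  have hf := floor_add_of_mem (n := 0) (by linarith : 0 ≤ x) (by linarith : x < 1)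
  simp only [Int.cast_zero, zero_add] at hf
  change ((⌊x⌋ : ℤ) : ℝ) + delta0Period (Int.fract x) = _
  rw [hf.1, hf.2, delta0Period, if_neg (by linarith), if_pos (by linarith)]
  simp

theorem delta0_add_half (x : ℝ) : delta0 (x + 1 / 2) = delta0.symm x + 1 / 2 := by
  have h0 := Int.fract_nonneg x
  have h1 := Int.fract_lt_one x
  have hx := Int.floor_add_fract x
  change ((⌊x + 1 / 2⌋ : ℤ) : ℝ) + delta0Period (Int.fract (x + 1 / 2)) =
    ((⌊x⌋ : ℤ) : ℝ) + delta0InvPeriod (Int.fract x) + 1 / 2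
  by_cases h : Int.fract x < 1 / 2
  · have hf := floor_add_of_mem (n := ⌊x⌋) (u := Int.fract x + 1 / 2) (by linarith) (by linarith)
    rw [show x + 1 / 2 = (⌊x⌋ : ℝ) + (Int.fract x + 1 / 2) by linarith, hf.1, hf.2]
    unfold delta0Period delta0InvPeriod
    split_ifs <;> linarith
  · have hf := floor_add_of_mem (n := ⌊x⌋ + 1) (u := Int.fract x - 1 / 2)
      (by linarith) (by linarith)
    rw [show x + 1 / 2 = ((⌊x⌋ + 1 : ℤ) : ℝ) + (Int.fract x - 1 / 2) by push_cast; linarith,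
      hf.1, hf.2]
    unfold delta0Period delta0InvPeriod
    push_cast
    split_ifs <;> linarith

theorem abs_delta0_sub_le (x : ℝ) : |delta0 x - x| ≤ 1 := by
  have h0 := Int.fract_nonneg x
  have h1 := Int.fract_lt_one x
  have hx := Int.floor_add_fract x
  change |((⌊x⌋ : ℤ) : ℝ) + delta0Period (Int.fract x) - x| ≤ 1
  rw [delta0Period, abs_le]
  split_ifs <;> constructor <;> linarith

/-- The homeomorphism `(x, y) ↦ (δ₀(x), y)`. -/
noncomputable def deltaMap : Plane ≃ₜ Plane where
  toFun w := !₂[delta0 (w 0), w 1]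
  invFun w := !₂[delta0.symm (w 0), w 1]
  left_inv w := by ext i; fin_cases i <;> simp
  right_inv w := by ext i; fin_cases i <;> simp
  continuous_toFun := by
    refine (PiLp.continuous_toLp 2 _).comp (continuous_pi fun i => ?_)
    fin_cases i <;> simp <;> fun_prop
  continuous_invFun := by
    refine (PiLp.continuous_toLp 2 _).comp (continuous_pi fun i => ?_)
    fin_cases i <;> simp <;> fun_prop

/-- The involution `η (x, y) = (y, x)`. -/
noncomputable def swapMap : Plane ≃ₜ Plane where
  toFun w := !₂[w 1, w 0]
  invFun w := !₂[w 1, w 0]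
  left_inv w := by ext i; fin_cases i <;> simp
  right_inv w := by ext i; fin_cases i <;> simp
  continuous_toFun := by
    refine (PiLp.continuous_toLp 2 _).comp (continuous_pi fun i => ?_)
    fin_cases i <;> simp <;> fun_prop
  continuous_invFun := by
    refine (PiLp.continuous_toLp 2 _).comp (continuous_pi fun i => ?_)
    fin_cases i <;> simp <;> fun_prop

/-- The six planar homeomorphisms `α = a^{1/12}`, `β = b^{1/12}`, `γ = c^{1/168}`, `δ`,
`ηγη` and `ηδη`. -/
noncomputable def planarGenerator : Fin 6 → (Plane ≃ₜ Plane) :=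
  ![translateX (1 / 12), translateY (1 / 12), shear (1 / 168), deltaMap,
    swapMap * shear (1 / 168) * swapMap, swapMap * deltaMap * swapMap]

/-! ### From the plane to the disk -/

/-- `f` moves all points of the plane by a bounded distance. -/
def BoundedDisplacement (f : Plane ≃ₜ Plane) : Prop := ∃ C : ℝ, ∀ w, ‖f w - w‖ ≤ C

theorem BoundedDisplacement.symm {f : Plane ≃ₜ Plane} (hf : BoundedDisplacement f) :
    BoundedDisplacement f.symm := by
  obtain ⟨C, hC⟩ := hf
  refine ⟨C, fun w => ?_⟩
  have := hC (f.symm w)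
  rwa [f.apply_symm_apply, norm_sub_rev] at this

theorem boundedDisplacement_planarGenerator (i : Fin 6) :
    BoundedDisplacement (planarGenerator i) := by
  refine ⟨1, fun w => ?_⟩
  have hx : ∀ v : Plane, |v 0| ≤ 1 → v 1 = 0 → ‖v‖ ≤ 1 := by
    intro v h0 h1
    rw [EuclideanSpace.norm_eq, Fin.sum_univ_two, h1]
    simpa [Real.sqrt_sq_eq_abs] using h0
  have hy : ∀ v : Plane, v 0 = 0 → |v 1| ≤ 1 → ‖v‖ ≤ 1 := by
    intro v h0 h1
    rw [EuclideanSpace.norm_eq, Fin.sum_univ_two, h0]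
    simpa [Real.sqrt_sq_eq_abs] using h1
  have hg : ∀ x, |1 / 168 * gamma0 x| ≤ 1 := by
    intro x
    have := abs_le.mp (abs_gamma0_le x)
    rw [abs_le]; constructor <;> linarith
  fin_cases i
  · refine hx _ ?_ ?_ <;> simp [planarGenerator, translateX]
    norm_num [abs_le]
  · refine hy _ ?_ ?_ <;> simp [planarGenerator, translateY]
    norm_num [abs_le]
  · refine hy _ ?_ ?_ <;> simp [planarGenerator, shear]
    simpa using hg (w 0)
  · refine hx _ ?_ ?_ <;> simp [planarGenerator, deltaMap]
    exact abs_delta0_sub_le _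
  · refine hx _ ?_ ?_ <;> simp [planarGenerator, shear, swapMap, Homeomorph.mul_apply]
    simpa using hg (w 1)
  · refine hy _ ?_ ?_ <;> simp [planarGenerator, deltaMap, swapMap, Homeomorph.mul_apply]
    exact abs_delta0_sub_le _

/-- The radial identification `w ↦ w / √(1 + ‖w‖²)` of the plane with the open unit disk. -/
noncomputable def toDisk (w : Plane) : Plane := (√(1 + ‖w‖ ^ 2))⁻¹ • w

/-- The inverse `z ↦ z / √(1 - ‖z‖²)` of `toDisk` on the open unit disk. -/
noncomputable def ofDisk (z : Plane) : Plane := (√(1 - ‖z‖ ^ 2))⁻¹ • z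

theorem norm_toDisk_lt (w : Plane) : ‖toDisk w‖ < 1 :=
  mem_ball_zero_iff.mp (OpenPartialHomeomorph.univUnitBall.map_source' (x := w) (Set.mem_univ _))

theorem ofDisk_toDisk (w : Plane) : ofDisk (toDisk w) = w :=
  OpenPartialHomeomorph.univUnitBall.left_inv' (x := w) (Set.mem_univ _)

theorem toDisk_ofDisk {z : Plane} (hz : ‖z‖ < 1) : toDisk (ofDisk z) = z :=
  OpenPartialHomeomorph.univUnitBall.right_inv' (x := z)
    (mem_ball_zero_iff.mpr hz)

theorem continuous_toDisk : Continuous toDisk :=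
  continuousOn_univ.mp OpenPartialHomeomorph.univUnitBall.continuousOn_toFun

theorem continuousOn_ofDisk : ContinuousOn ofDisk (Metric.ball 0 1) :=
  OpenPartialHomeomorph.univUnitBall.continuousOn_invFun

theorem norm_toDisk_sub_le (v w : Plane) :
    ‖toDisk v - toDisk w‖ ≤ 2 * ((√(1 + ‖w‖ ^ 2))⁻¹ * ‖v - w‖) := by
  set a := √(1 + ‖v‖ ^ 2) with ha
  set b := √(1 + ‖w‖ ^ 2) with hb
  have ha2 : a ^ 2 = 1 + ‖v‖ ^ 2 := Real.sq_sqrt (by positivity)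
  have hb2 : b ^ 2 = 1 + ‖w‖ ^ 2 := Real.sq_sqrt (by positivity)
  have ha0 : 0 < a := Real.sqrt_pos.mpr (by positivity)
  have hb0 : 0 < b := Real.sqrt_pos.mpr (by positivity)
  have hva : ‖v‖ ≤ a := by nlinarith [norm_nonneg v]
  have hwb : ‖w‖ ≤ b := by nlinarith [norm_nonneg w]
  have hab : |b - a| ≤ ‖v - w‖ := by
    have h1 : |b - a| * (b + a) = |‖w‖ - ‖v‖| * (‖w‖ + ‖v‖) := by
      have e1 : |b - a| * |b + a| = |‖w‖ - ‖v‖| * |‖w‖ + ‖v‖| := by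
        rw [← abs_mul, ← abs_mul]
        congr 1
        linarith [sq_sub_sq b a, sq_sub_sq ‖w‖ ‖v‖]
      rwa [abs_of_pos (by positivity : 0 < b + a),
        abs_of_nonneg (by positivity : 0 ≤ ‖w‖ + ‖v‖)] at e1
    have h2 : |‖w‖ - ‖v‖| ≤ ‖v - w‖ := by
      rw [norm_sub_rev]; exact abs_norm_sub_norm_le w v
    have h3 : |b - a| * (b + a) ≤ ‖v - w‖ * (b + a) := by
      rw [h1]
      exact mul_le_mul h2 (by linarith) (by positivity) (norm_nonneg _)
    exact le_of_mul_le_mul_right h3 (by positivity)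
  have e : toDisk v - toDisk w = b⁻¹ • (v - w) + (b⁻¹ * (b - a)) • (a⁻¹ • v) := by
    unfold toDisk
    rw [← ha, ← hb, smul_smul, smul_sub,
      show b⁻¹ * (b - a) * a⁻¹ = a⁻¹ - b⁻¹ by field_simp, sub_smul]
    abel
  have h1 : ‖a⁻¹ • v‖ ≤ 1 := (norm_toDisk_lt v).le
  rw [e]
  refine (norm_add_le _ _).trans ?_
  rw [norm_smul, norm_smul (b⁻¹ * (b - a)), norm_mul, Real.norm_eq_abs, Real.norm_eq_abs,
    abs_of_pos (inv_pos.mpr hb0)]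
  have h4 : b⁻¹ * |b - a| * ‖a⁻¹ • v‖ ≤ b⁻¹ * ‖v - w‖ * 1 := by gcongr
  linarith

/-- The map of the plane that is `f` on the open unit disk, seen as the plane through `toDisk`, and
the identity elsewhere. -/
noncomputable def diskMap (f : Plane ≃ₜ Plane) (z : Plane) : Plane :=
  if ‖z‖ < 1 then toDisk (f (ofDisk z)) else z

theorem diskMap_of_lt (f : Plane ≃ₜ Plane) {z : Plane} (hz : ‖z‖ < 1) :
    diskMap f z = toDisk (f (ofDisk z)) := if_pos hz

theorem diskMap_of_not_lt (f : Plane ≃ₜ Plane) {z : Plane} (hz : ¬ ‖z‖ < 1) :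
    diskMap f z = z := if_neg hz

theorem diskMap_mem (f : Plane ≃ₜ Plane) (z : Disk) :
    diskMap f z ∈ Metric.closedBall (0 : Plane) 1 := by
  by_cases hz : ‖(z : Plane)‖ < 1
  · rw [diskMap_of_lt f hz, mem_closedBall_zero_iff]
    exact (norm_toDisk_lt _).le
  · rw [diskMap_of_not_lt f hz]
    exact z.2

theorem diskMap_symm_diskMap (f : Plane ≃ₜ Plane) (z : Plane) :
    diskMap f.symm (diskMap f z) = z := by
  by_cases hz : ‖z‖ < 1
  · rw [diskMap_of_lt f hz, diskMap_of_lt _ (norm_toDisk_lt _), ofDisk_toDisk,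
      f.symm_apply_apply, toDisk_ofDisk hz]
  · rw [diskMap_of_not_lt f hz, diskMap_of_not_lt _ hz]

theorem continuous_diskMap {f : Plane ≃ₜ Plane} (hf : BoundedDisplacement f) :
    Continuous fun z : Disk => diskMap f z := by
  obtain ⟨C, hC⟩ := hf
  have bound : ∀ z : Disk, ‖diskMap f z - z‖ ≤ 2 * (√(1 - ‖(z : Plane)‖ ^ 2) * C) := by
    intro z
    have hz1 : ‖(z : Plane)‖ ≤ 1 := mem_closedBall_zero_iff.mp z.2
    have hC0 : 0 ≤ C := (norm_nonneg _).trans (hC 0)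
    by_cases hz : ‖(z : Plane)‖ < 1
    · have h := norm_toDisk_sub_le (f (ofDisk z)) (ofDisk z)
      rw [toDisk_ofDisk hz] at h
      have hpos : 0 < 1 - ‖(z : Plane)‖ ^ 2 := by nlinarith [norm_nonneg (z : Plane)]
      have h2 : (√(1 + ‖ofDisk z‖ ^ 2))⁻¹ = √(1 - ‖(z : Plane)‖ ^ 2) := by
        rw [← Real.sqrt_inv]
        congr 1
        rw [ofDisk, norm_smul, mul_pow, norm_inv, Real.norm_eq_abs, inv_pow, sq_abs,
          Real.sq_sqrt hpos.le]
        field_simp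
        ring
      rw [diskMap_of_lt f hz]
      rw [h2] at h
      refine h.trans ?_
      have := hC (ofDisk z)
      gcongr
    · rw [diskMap_of_not_lt f hz, sub_self, norm_zero]
      positivity
  rw [continuous_iff_continuousAt]
  intro z
  by_cases hz : ‖(z : Plane)‖ < 1
  · have hball : Metric.ball (0 : Plane) 1 ∈ nhds (z : Plane) :=
      Metric.isOpen_ball.mem_nhds (by simpa using hz)
    have hc : ContinuousAt (fun y : Plane => toDisk (f (ofDisk y))) (z : Plane) :=
      continuous_toDisk.continuousAt.comp
        (f.continuous.continuousAt.comp (continuousOn_ofDisk.continuousAt hball))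
    have hc2 : ContinuousAt (diskMap f) (z : Plane) := by
      refine hc.congr ?_
      filter_upwards [hball] with y hy
      exact (diskMap_of_lt f (by simpa using hy)).symm
    exact hc2.comp continuous_subtype_val.continuousAt
  · have hz1 : ‖(z : Plane)‖ = 1 :=
      le_antisymm (mem_closedBall_zero_iff.mp z.2) (not_lt.mp hz)
    have hlim : Filter.Tendsto (fun y : Disk => diskMap f y - y) (nhds z) (nhds 0) := by
      refine squeeze_zero_norm bound ?_
      have hcont : Continuous fun y : Disk => 2 * (√(1 - ‖(y : Plane)‖ ^ 2) * C) := by fun_prop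
      have := hcont.tendsto z
      simpa [hz1] using this
    have h := hlim.add (continuous_subtype_val.tendsto z)
    simp only [sub_add_cancel, zero_add] at h
    have e : diskMap f z = z := diskMap_of_not_lt f hz
    rw [← e] at h
    exact h

/-- A homeomorphism of the plane with bounded displacement, seen as an element of `Homeo(D, ∂D)`:
the plane is identified with the open disk by `toDisk`, and the boundary is fixed pointwise. -/
noncomputable def toHomeoDisk (f : Plane ≃ₜ Plane) (hf : BoundedDisplacement f) :
    homeoDiskRelBoundary where
  val :=
    { toFun := fun z => ⟨diskMap f z, diskMap_mem f z⟩
      invFun := fun z => ⟨diskMap f.symm z, diskMap_mem f.symm z⟩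
      left_inv := fun z => Subtype.ext (diskMap_symm_diskMap f z)
      right_inv := fun z => Subtype.ext (by simpa using diskMap_symm_diskMap f.symm z)
      continuous_toFun := (continuous_diskMap hf).subtype_mk _
      continuous_invFun := (continuous_diskMap hf.symm).subtype_mk _ }
  property := fun _ hz => Subtype.ext (diskMap_of_not_lt f (by rw [hz]; exact lt_irrefl 1))

/-- The six elements `α, β, γ, δ, ηγη, ηδη` of `Homeo(D, ∂D)`. -/
noncomputable def diskGenerator (i : Fin 6) : homeoDiskRelBoundary :=
  toHomeoDisk (planarGenerator i) (boundedDisplacement_planarGenerator i)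

/-! ### Klein systems in a group -/

/-! Conjugation by `α ^ 6`, the horizontal translation by 1/2, inverts `γ` and `δ`, because a
half-period shift changes the sign of `γ₀` and turns `δ₀` into its inverse. Moreover the translates
of `γ₀ ∘ δ₀ - 2γ₀` by 0, 1/3 and 2/3 add up to 1, so `β ^ 6` is a power of a product of commuting
conjugates of powers of `γ ^ 2`. These relations form a `KleinSystem` (`kleinSystem_translateX`),
and exchanging the coordinates gives a second one with `α` and `β` interchanged.

In a group of circle homeomorphisms every square preserves orientation; this is what the square
roots provide. The relations therefore lift to increasing homeomorphisms of the line, up to integer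
translations. An increasing map inverted by `s` has a fixed point between `p` and `s p`
(`exists_fixed_of_klein`), hence one in every gap of the fixed point set of `s`. So do the
conjugates in the product. Since they commute, they have a common fixed point in each gap
(`exists_common_fixed`). Thus some lift `w` of the product has a fixed point in every gap of every
lift of `A ^ 6` (`KleinSystem.exists_lift`).

The second system gives a similar map `v` for the lifts of `B ^ 6`. But `w ^ 42` and `v ^ 42` are
themselves lifts of `B ^ 6` and `A ^ 6`, with the same fixed points as `w` and `v`. Each of `v`, `w`
thus has fixed points in all gaps of the other, which forces `v = 1` and `A ^ 6 = 1`
(`pow_six_eq_one_of_kleinSystem`), whereas `α ^ 6 ≠ 1`. -/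

/-- The conjugates of `c` by `a^{-4j}` and by `a^{-4j} d⁻¹`, for `j < 3`. -/
def towerConj {G : Type*} [Group G] (a c d : G) (i : Fin 3 × Bool) : G :=
  ((a ^ (4 * (i.1 : ℕ)))⁻¹ * (if i.2 then d⁻¹ else 1)) * c *
    ((a ^ (4 * (i.1 : ℕ)))⁻¹ * (if i.2 then d⁻¹ else 1))⁻¹

/-- The product over `j < 3` of the conjugates of `d⁻¹ c d c⁻²` by `a^{-4j}`. -/
def towerProd {G : Type*} [Group G] (a c d : G) : G :=
  (towerConj a c d (0, true) * (towerConj a c d (0, false))⁻¹ ^ 2) *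
  (towerConj a c d (1, true) * (towerConj a c d (1, false))⁻¹ ^ 2) *
  (towerConj a c d (2, true) * (towerConj a c d (2, false))⁻¹ ^ 2)

/-- The relations between `a`, `c`, `d` and `b`: conjugation by `a ^ 6` inverts `c` and `d`, and
`b ^ 6` is a product of commuting conjugates of powers of `c ^ 2`. -/
structure KleinSystem {G : Type*} [Group G] (a c d b : G) : Prop where
  klein_c : (a ^ 6)⁻¹ * c * a ^ 6 = c⁻¹
  klein_d : (a ^ 6)⁻¹ * d * a ^ 6 = d⁻¹
  comm : ∀ i j, Commute (towerConj a (c ^ 2) d i) (towerConj a (c ^ 2) d j)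
  prod : towerProd a (c ^ 2) d ^ 42 = b ^ 6

section Map

variable {G H : Type*} [Group G] [Group H]

theorem map_towerConj (φ : G →* H) (a c d : G) (i : Fin 3 × Bool) :
    φ (towerConj a c d i) = towerConj (φ a) (φ c) (φ d) i := by
  obtain ⟨j, t⟩ := i
  cases t <;> simp [towerConj]

theorem map_towerProd (φ : G →* H) (a c d : G) :
    φ (towerProd a c d) = towerProd (φ a) (φ c) (φ d) := by
  simp only [towerProd, map_mul, map_pow, map_inv, map_towerConj]

theorem KleinSystem.map (φ : G →* H) {a c d b : G} (h : KleinSystem a c d b) :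
    KleinSystem (φ a) (φ c) (φ d) (φ b) where
  klein_c := by simpa using congrArg φ h.klein_c
  klein_d := by simpa using congrArg φ h.klein_d
  comm i j := by
    have := (h.comm i j).map φ
    rwa [map_towerConj, map_towerConj, map_pow] at this
  prod := by
    have := congrArg φ h.prod
    rwa [map_pow, map_towerProd, map_pow, map_pow] at this

theorem KleinSystem.of_map (φ : G →* H) (hφ : Function.Injective φ) {a c d b : G}
    (h : KleinSystem (φ a) (φ c) (φ d) (φ b)) : KleinSystem a c d b where
  klein_c := hφ (by simpa using h.klein_c)
  klein_d := hφ (by simpa using h.klein_d)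
  comm i j := by
    have := h.comm i j
    rw [← map_pow, ← map_towerConj, ← map_towerConj] at this
    exact hφ (by simpa using this.eq)
  prod := hφ (by rw [map_pow, map_towerProd, map_pow, map_pow, h.prod])

end Map

/-! ### Dynamics on the line -/

/-- If `c` moves `p` to the right, then `c (s p) = s (c⁻¹ p)` lies to the left of `s p`, and
conversely; the intermediate value theorem applies to `c x - x`. -/
theorem exists_fixed_of_klein {s c : ℝ ≃o ℝ} (h : s⁻¹ * c * s = c⁻¹) (p : ℝ) :
    ∃ x ∈ Set.uIcc p (s p), c x = x := by
  have h1 : c (s p) = s (c⁻¹ p) := by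
    have : c * s = s * c⁻¹ := by rw [← h]; group
    exact DFunLike.congr_fun this p
  have hcont : ContinuousOn (fun x => c x - x) (Set.uIcc p (s p)) :=
    (c.continuous.sub continuous_id).continuousOn
  have hz : (0 : ℝ) ∈ Set.uIcc (c p - p) (c (s p) - s p) := by
    rw [Set.mem_uIcc]
    rcases le_total p (c p) with hp | hp
    · right
      have : c⁻¹ p ≤ p := by
        have := (c⁻¹ : ℝ ≃o ℝ).monotone hp
        rwa [RelIso.inv_apply_self] at this
      have := s.monotone this
      constructor <;> linarith
    · left
      have : p ≤ c⁻¹ p := by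
        have := (c⁻¹ : ℝ ≃o ℝ).monotone hp
        rwa [RelIso.inv_apply_self] at this
      have := s.monotone this
      constructor <;> linarith
  obtain ⟨x, hx, hx0⟩ := intermediate_value_uIcc hcont hz
  exact ⟨x, hx, sub_eq_zero.mp hx0⟩

theorem fixed_of_klein {s c : ℝ ≃o ℝ} (h : s⁻¹ * c * s = c⁻¹) {p : ℝ} (hp : s p = p) :
    c p = p := by
  obtain ⟨x, hx, hxc⟩ := exists_fixed_of_klein h p
  rw [hp, Set.uIcc_self, Set.mem_singleton_iff] at hx
  rwa [hx] at hxc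

theorem apply_inv_fixed {f : ℝ ≃o ℝ} {p : ℝ} (hp : f p = p) : f⁻¹ p = p := by
  conv_lhs => rw [← hp]
  exact RelIso.inv_apply_self f p

theorem apply_comm {f g : ℝ ≃o ℝ} (h : Commute f g) (p : ℝ) : f (g p) = g (f p) :=
  DFunLike.congr_fun h.eq p

theorem fixed_of_pow {f : ℝ ≃o ℝ} {n : ℕ} (hn : n ≠ 0) {p : ℝ} (hp : (f ^ n) p = p) :
    f p = p := by
  have hit : ∀ k : ℕ, ((f ^ k : ℝ ≃o ℝ)) p = f^[k] p := by
    intro k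
    induction k with
    | zero => rfl
    | succ k ih => rw [pow_succ', RelIso.mul_apply, ih, Function.iterate_succ_apply']
  rw [hit] at hp
  rcases lt_trichotomy (f p) p with h | h | h
  · exact absurd hp (f.strictMono.strictAnti_iterate_of_map_lt h (Nat.pos_of_ne_zero hn)).ne
  · exact h
  · exact absurd hp (f.strictMono.strictMono_iterate_of_lt_map h (Nat.pos_of_ne_zero hn)).ne'

theorem pow_fixed {f : ℝ ≃o ℝ} {p : ℝ} (hp : f p = p) (n : ℕ) : (f ^ n) p = p := by
  induction n with
  | zero => rfl
  | succ k ih => rw [pow_succ', RelIso.mul_apply, ih, hp]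

/-- An orbit of a map without fixed points in an order-connected set is unbounded there. -/
theorem exists_le_zpow_apply {z : ℝ ≃o ℝ} {I : Set ℝ} (hI : I.OrdConnected)
    (hz : ∀ y ∈ I, z y ≠ y) {x y : ℝ} (hx : x ∈ I) (hy : y ∈ I) :
    ∃ m : ℤ, x ≤ (z ^ m) y := by
  by_contra! hcon
  have hbdd : BddAbove (Set.range fun m : ℤ => (z ^ m) y) :=
    ⟨x, by rintro _ ⟨m, rfl⟩; exact (hcon m).le⟩
  -- The supremum of a bounded full orbit is a fixed point of `z`, and it would lie between `y` and
  -- `x`.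
  set S := ⨆ m : ℤ, (z ^ m) y with hS
  have h1 : y ≤ S := le_ciSup hbdd 0
  have h2 : S ≤ x := ciSup_le fun m => (hcon m).le
  refine hz S (hI.out hy hx ⟨h1, h2⟩) ?_
  rw [hS, z.map_ciSup hbdd]
  refine Equiv.iSup_congr (Equiv.addRight 1) fun m => ?_
  change (z ^ (m + 1)) y = _
  rw [add_comm, zpow_add, zpow_one, RelIso.mul_apply]

/-- Translating a fixed point of `h k` by powers of `z` gives fixed points of `h k` on both sides of
a common fixed point of the earlier maps. Between two of them, the earlier common fixed points form
a compact set preserved by `h k` and its inverse, so its maximum is fixed by `h k`. -/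
theorem exists_common_fixed {ι : Type*} [Finite ι] {h : ι → (ℝ ≃o ℝ)} {z : ℝ ≃o ℝ} {I : Set ℝ}
    (hI : I.OrdConnected) (hne : I.Nonempty) (hzI : ∀ y ∈ I, z y ∈ I) (hzI' : ∀ y ∈ I, z⁻¹ y ∈ I)
    (hz : ∀ y ∈ I, z y ≠ y) (hzc : ∀ i, Commute z (h i)) (hc : ∀ i j, Commute (h i) (h j))
    (hfix : ∀ i, ∃ y ∈ I, h i y = y) : ∃ x ∈ I, ∀ i, h i x = x := by
  classical
  have hzm : ∀ (m : ℤ), ∀ y ∈ I, (z ^ m) y ∈ I := by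
    intro m
    induction m with
    | zero => intro y hy; simpa using hy
    | succ n ih => intro y hy; rw [zpow_add_one]; exact ih _ (hzI _ hy)
    | pred n ih => intro y hy; rw [zpow_sub_one]; exact ih _ (hzI' _ hy)
  have key : ∀ s : Finset ι, ∃ x ∈ I, ∀ i ∈ s, h i x = x := by
    intro s
    induction s using Finset.induction_on with
    | empty => exact ⟨hne.some, hne.some_mem, by simp⟩
    | insert k s _ ih =>
      obtain ⟨x, hxI, hx⟩ := ih
      obtain ⟨y, hyI, hy⟩ := hfix k
      have hky : ∀ m : ℤ, h k ((z ^ m) y) = (z ^ m) y := by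
        intro m
        rw [← apply_comm ((hzc k).zpow_left m), hy]
      obtain ⟨m, hm⟩ := exists_le_zpow_apply hI hz hxI hyI
      obtain ⟨n, hn⟩ := exists_le_zpow_apply hI hz hyI hxI
      have hn' : (z ^ (-n)) y ≤ x := by
        have := (z ^ (-n) : ℝ ≃o ℝ).monotone hn
        rwa [← RelIso.mul_apply, ← zpow_add, neg_add_cancel, zpow_zero, RelIso.one_apply] at this
      set K := Set.Icc ((z ^ (-n)) y) ((z ^ m) y) ∩ {w | ∀ i ∈ s, h i w = w} with hK
      have hKc : IsCompact K := by
        refine isCompact_Icc.inter_right ?_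
        have : {w | ∀ i ∈ s, h i w = w} = ⋂ i ∈ s, {w | h i w = w} := by ext; simp
        rw [this]
        exact isClosed_biInter fun i _ => isClosed_eq (h i).continuous continuous_id
      obtain ⟨w, hw⟩ := hKc.exists_isGreatest ⟨x, ⟨hn', hm⟩, hx⟩
      have hinv : ∀ g : ℝ ≃o ℝ, (∀ m : ℤ, g ((z ^ m) y) = (z ^ m) y) →
          (∀ i, Commute (h i) g) → g w ∈ K := by
        intro g hg hgc
        refine ⟨⟨?_, ?_⟩, fun i hi => ?_⟩
        · rw [← hg]; exact g.monotone hw.1.1.1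
        · rw [← hg m]; exact g.monotone hw.1.1.2
        · rw [apply_comm (hgc i), hw.1.2 i hi]
      have h1 := hw.2 (hinv (h k) hky fun i => hc i k)
      have h2 := hw.2 (hinv (h k)⁻¹ (fun m => apply_inv_fixed (hky m)) fun i => (hc i k).inv_right)
      have h3 : w ≤ h k w := by
        have := (h k).monotone h2
        rwa [RelIso.apply_inv_self] at this
      refine ⟨w, hI.out (hzm _ _ hyI) (hzm _ _ hyI) hw.1.1, fun i hi => ?_⟩
      rcases Finset.mem_insert.mp hi with rfl | hi
      · exact le_antisymm h1 h3
      · exact hw.1.2 i hi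
  cases nonempty_fintype ι
  obtain ⟨x, hxI, hx⟩ := key Finset.univ
  exact ⟨x, hxI, fun i => hx i (Finset.mem_univ i)⟩

/-! ### Gaps of a set of fixed points -/

/-- The complementary component of `p` with respect to the set `F`. -/
def gapAround (F : Set ℝ) (p : ℝ) : Set ℝ := {x | ∀ q ∈ F, (q < x ↔ q < p) ∧ (x < q ↔ p < q)}

theorem ordConnected_gapAround (F : Set ℝ) (p : ℝ) : (gapAround F p).OrdConnected := by
  refine ⟨fun x hx y hy w hw q hq => ⟨⟨fun h => ?_, fun h => ?_⟩, ⟨fun h => ?_, fun h => ?_⟩⟩⟩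
  · exact (hy q hq).1.mp (h.trans_le hw.2)
  · exact ((hx q hq).1.mpr h).trans_le hw.1
  · exact (hx q hq).2.mp (hw.1.trans_lt h)
  · exact hw.2.trans_lt ((hy q hq).2.mpr h)

theorem self_mem_gapAround (F : Set ℝ) (p : ℝ) : p ∈ gapAround F p := fun _ _ => by simp

theorem apply_mem_gapAround {F : Set ℝ} {p : ℝ} {g : ℝ ≃o ℝ} (hg : ∀ q ∈ F, g q = q) {x : ℝ}
    (hx : x ∈ gapAround F p) : g x ∈ gapAround F p := by
  intro q hq
  have h1 : q < g x ↔ q < x := by conv_lhs => rw [← hg q hq, g.lt_iff_lt]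
  have h2 : g x < q ↔ x < q := by conv_lhs => rw [← hg q hq, g.lt_iff_lt]
  rw [h1, h2]
  exact hx q hq

theorem disjoint_gapAround {F : Set ℝ} {p q : ℝ} (hp : p ∉ F) (hq : q ∈ F) :
    q ∉ gapAround F p := by
  intro h
  have := h q hq
  simp only [lt_self_iff_false, false_iff, not_lt] at this
  exact hp (le_antisymm this.1 this.2 ▸ hq)

/-- The translation `x ↦ x + 1` of the line. -/
noncomputable def unitShift : ℝ ≃o ℝ := OrderIso.addRight 1

theorem unitShift_zpow_apply (k : ℤ) (x : ℝ) : (unitShift ^ k) x = x + k := by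
  have h1 : ∀ y, unitShift y = y + 1 := fun y => rfl
  have h2 : ∀ y, unitShift⁻¹ y = y - 1 := fun y => by
    conv_lhs => rw [← sub_add_cancel y 1, ← h1 (y - 1), RelIso.inv_apply_self]
  induction k generalizing x with
  | zero => simp
  | succ n ih => rw [zpow_add_one, RelIso.mul_apply, h1, ih]; push_cast; ring
  | pred n ih => rw [zpow_sub_one, RelIso.mul_apply, h2, ih]; push_cast; ring

theorem unitShift_apply_ne (x : ℝ) : unitShift x ≠ x := (lt_add_one x).ne'

/-! ### Fixed points of the conjugates of an inverted element -/

theorem conj_klein {G : Type*} [Group G] {s c : G} (h : s⁻¹ * c * s = c⁻¹) (u : G) :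
    (u * s * u⁻¹)⁻¹ * (u * c * u⁻¹) * (u * s * u⁻¹) = (u * c * u⁻¹)⁻¹ := by
  calc _ = u * (s⁻¹ * c * s) * u⁻¹ := by group
    _ = _ := by rw [h]; group

/-- The conjugate of `c` is inverted by `u * s * u⁻¹`. By `hu` this map fixes every fixed point of
`s`, so it keeps `p` in its gap. -/
theorem exists_fixed_conj_gapAround {s c u : ℝ ≃o ℝ} (h : s⁻¹ * c * s = c⁻¹)
    (hu : ∀ p, s p = p → s (u⁻¹ p) = u⁻¹ p) (p : ℝ) :
    ∃ x ∈ gapAround {q | s q = q} p, (u * c * u⁻¹) x = x := by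
  obtain ⟨x, hx, hcx⟩ := exists_fixed_of_klein (conj_klein h u) p
  refine ⟨x, (ordConnected_gapAround _ p).uIcc_subset (self_mem_gapAround _ p) ?_ hx, hcx⟩
  refine apply_mem_gapAround (fun q hq => ?_) (self_mem_gapAround _ p)
  change u (s (u⁻¹ q)) = q
  rw [hu q hq, RelIso.apply_inv_self]

/-- Although `d` is inverted only up to `t`, the map `t⁻¹ * d ^ 2` is inverted exactly and so fixes
`q`. Hence `d (d q) = t q`, and the relation at `q` becomes `d q = s (d q)`. -/
theorem fixed_apply_of_klein_mod {s d t : ℝ ≃o ℝ} (h : s⁻¹ * d * s = t * d⁻¹)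
    (htd : Commute t d) (hts : Commute t s) {q : ℝ} (hq : s q = q) : s (d q) = d q := by
  have he : s⁻¹ * (t⁻¹ * d ^ 2) * s = (t⁻¹ * d ^ 2)⁻¹ := by
    calc s⁻¹ * (t⁻¹ * d ^ 2) * s = t⁻¹ * ((s⁻¹ * d * s) * (s⁻¹ * d * s)) := by
          rw [← mul_assoc, ← (hts.inv_right.inv_left).eq, pow_two]; group
      _ = t⁻¹ * (t * (t * d⁻¹) * d⁻¹) := by
          rw [h, show t * d⁻¹ * (t * d⁻¹) = t * (d⁻¹ * t) * d⁻¹ by group, (htd.inv_right).eq]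
      _ = (t⁻¹ * d ^ 2)⁻¹ := by
          rw [(htd.inv_left.pow_right 2).eq]; group
  have h1 : d (d q) = t q := by
    have := congrArg t (fixed_of_klein he hq)
    change t (t⁻¹ (d (d q))) = t q at this
    rwa [RelIso.apply_inv_self] at this
  have h2 : d (s q) = s (t (d⁻¹ q)) := by
    have : d * s = s * (t * d⁻¹) := by rw [← h]; group
    exact DFunLike.congr_fun this q
  rw [hq, apply_comm htd.inv_right, ← h1, RelIso.inv_apply_self] at h2
  exact h2.symm

theorem commute_towerConj {G : Type*} [Group G] {z a c d : G} (ha : Commute z a)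
    (hc : Commute z c) (hd : Commute z d) (i : Fin 3 × Bool) :
    Commute z (towerConj a c d i) := by
  have hu : Commute z ((a ^ (4 * (i.1 : ℕ)))⁻¹ * (if i.2 then d⁻¹ else 1)) := by
    refine (ha.pow_right _).inv_right.mul_right ?_
    split_ifs
    exacts [hd.inv_right, Commute.one_right z]
  exact (hu.mul_right hc).mul_right hu.inv_right

theorem towerProd_fixed {a c d : ℝ ≃o ℝ} {x : ℝ} (h : ∀ i, towerConj a c d i x = x) :
    towerProd a c d x = x := by
  have h2 : ∀ j, (towerConj a c d (j, true) * (towerConj a c d (j, false))⁻¹ ^ 2) x = x := by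
    intro j
    rw [RelIso.mul_apply, pow_fixed (apply_inv_fixed (h _)), h]
  simp only [towerProd]
  rw [RelIso.mul_apply, h2, RelIso.mul_apply, h2, h2]

section Line

variable {a c d s : ℝ ≃o ℝ} {l m : ℤ}

theorem exists_fixed_towerConj (hTa : Commute unitShift a)
    (hTd : Commute unitShift d) (hs : s = unitShift ^ l * a ^ 6)
    (hc : s⁻¹ * c * s = c⁻¹) (hd : s⁻¹ * d * s = unitShift ^ m * d⁻¹) (i : Fin 3 × Bool) (p : ℝ) :
    ∃ x ∈ gapAround {q | s q = q} p, towerConj a c d i x = x := by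
  have hTs : Commute unitShift s := by
    rw [hs]; exact ((Commute.refl _).zpow_right l).mul_right (hTa.pow_right 6)
  have has : Commute s a := by
    rw [hs]; exact (hTa.zpow_left l).mul_left ((Commute.refl a).pow_left 6)
  refine exists_fixed_conj_gapAround hc (fun q hq => ?_) p
  have h1 : s ((a ^ (4 * (i.1 : ℕ))) q) = (a ^ (4 * (i.1 : ℕ))) q := by
    rw [apply_comm (has.pow_right _), hq]
  obtain ⟨j, t⟩ := i
  cases t
  · simpa using h1
  · simpa [RelIso.mul_apply] using
      fixed_apply_of_klein_mod hd (hTd.zpow_left m) (hTs.zpow_left m) h1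

theorem exists_fixed_towerProd (hTa : Commute unitShift a) (hTc : Commute unitShift c)
    (hTd : Commute unitShift d) (hs : s = unitShift ^ l * a ^ 6)
    (hc : s⁻¹ * c * s = c⁻¹) (hd : s⁻¹ * d * s = unitShift ^ m * d⁻¹)
    (hcomm : ∀ i j, Commute (towerConj a c d i) (towerConj a c d j)) :
    ∃ x, towerProd a c d x = x := by
  obtain ⟨x, -, hx⟩ := exists_common_fixed (z := unitShift) Set.ordConnected_univ Set.univ_nonempty
    (fun y _ => Set.mem_univ _) (fun y _ => Set.mem_univ _) (fun y _ => unitShift_apply_ne y)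
    (commute_towerConj hTa hTc hTd) hcomm fun i => by
      obtain ⟨x, -, hx⟩ := exists_fixed_towerConj hTa hTd hs hc hd i 0
      exact ⟨x, Set.mem_univ _, hx⟩
  exact ⟨x, towerProd_fixed hx⟩

theorem exists_fixed_towerProd_gapAround (hTa : Commute unitShift a)
    (hTd : Commute unitShift d) (hs : s = unitShift ^ l * a ^ 6)
    (hc : s⁻¹ * c * s = c⁻¹) (hd : s⁻¹ * d * s = unitShift ^ m * d⁻¹)
    (hcomm : ∀ i j, Commute (towerConj a c d i) (towerConj a c d j)) (p : ℝ) :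
    ∃ x ∈ gapAround {q | s q = q} p, towerProd a c d x = x := by
  have hfix := fun i => exists_fixed_towerConj hTa hTd hs hc hd i p
  suffices ∃ x ∈ gapAround {q | s q = q} p, ∀ i, towerConj a c d i x = x by
    obtain ⟨x, hx, h⟩ := this
    exact ⟨x, hx, towerProd_fixed h⟩
  by_cases hp : s p = p
  -- The gap of a point of the set is that point alone.
  · refine ⟨p, self_mem_gapAround _ p, fun i => ?_⟩
    obtain ⟨x, hx, h⟩ := hfix i
    have := hx p hp
    simp only [lt_self_iff_false, iff_false, not_lt] at this
    rwa [le_antisymm this.1 this.2] at h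
  · have hTs : Commute unitShift s := by
      rw [hs]; exact ((Commute.refl _).zpow_right l).mul_right (hTa.pow_right 6)
    have has : Commute s a := by
      rw [hs]; exact (hTa.zpow_left l).mul_left ((Commute.refl a).pow_left 6)
    -- Inverting twice does nothing, so `s ^ 2` commutes with `c` and `d`. It plays the role of `z`
    -- in `exists_common_fixed`: being increasing, `s` has the same fixed points as `s ^ 2`, so
    -- there are none in this gap.
    have hsq : ∀ g t : ℝ ≃o ℝ, s⁻¹ * g * s = t * g⁻¹ → Commute t s → Commute t g →
        Commute (s ^ 2) g := by
      intro g t h hts htg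
      have h1 : g * s = s * (t * g⁻¹) := by rw [← h]; group
      have h2 : g⁻¹ * s = s * (g * t⁻¹) := by
        have := congrArg (fun w => w⁻¹) h
        simp only [mul_inv_rev, inv_inv] at this
        rw [← this]; group
      refine Commute.symm ?_
      change g * s ^ 2 = s ^ 2 * g
      calc g * s ^ 2 = (g * s) * s := by rw [pow_two, mul_assoc]
        _ = s * t * (g⁻¹ * s) := by rw [h1]; group
        _ = s * (t * s) * g * t⁻¹ := by rw [h2]; group
        _ = s * s * (t * g) * t⁻¹ := by rw [hts.eq]; group
        _ = s ^ 2 * g := by rw [htg.eq, pow_two]; group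
    have hz : ∀ i, Commute (s ^ 2) (towerConj a c d i) :=
      commute_towerConj (has.pow_left 2)
        (hsq c 1 (by rw [hc, one_mul]) (Commute.one_left _) (Commute.one_left _))
        (hsq d _ hd (hTs.zpow_left m) (hTd.zpow_left m))
    refine exists_common_fixed (ordConnected_gapAround _ p) ⟨p, self_mem_gapAround _ p⟩
      (fun y hy => apply_mem_gapAround (fun q hq => pow_fixed hq 2) hy)
      (fun y hy => apply_mem_gapAround (fun q hq => apply_inv_fixed (pow_fixed hq 2)) hy)
      (fun y hy h => disjoint_gapAround (F := {q | s q = q}) hp ?_ hy) hz hcomm hfix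
    exact fixed_of_pow two_ne_zero h

end Line

/-- The map `y` fixes all `q + n`, so `x q` and `y (x q)` lie in the same interval `[q + n, q + n +
1)`. They differ by the integer `k`, which is therefore zero. -/
theorem commute_of_commute_mod_unitShift {x y : ℝ ≃o ℝ} (hTy : Commute unitShift y) {k : ℤ}
    (h : x * y = unitShift ^ k * (y * x)) {q : ℝ} (hq : y q = q) : Commute x y := by
  have h1 : x q = y (x q) + k := by
    have := DFunLike.congr_fun h q
    rw [RelIso.mul_apply, hq, RelIso.mul_apply, RelIso.mul_apply, unitShift_zpow_apply] at this
    exact this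
  have h2 : ∀ n : ℤ, y (q + n) = q + n := by
    intro n
    rw [← unitShift_zpow_apply, ← apply_comm (hTy.zpow_left n), hq]
  have h3 : y (q + ⌊x q - q⌋) ≤ y (x q) := y.monotone (by linarith [Int.floor_le (x q - q)])
  have h4 : y (x q) < y (q + (⌊x q - q⌋ + 1 : ℤ)) :=
    y.strictMono (by push_cast; linarith [Int.lt_floor_add_one (x q - q)])
  rw [h2] at h3 h4
  push_cast at h4
  have h5 := Int.floor_le (x q - q)
  have h6 := Int.lt_floor_add_one (x q - q)
  have hk : k = 0 := by
    have h7 : (k : ℝ) < 1 := by linarith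
    have h8 : (-1 : ℝ) < k := by linarith
    have h9 : k < 1 := by exact_mod_cast h7
    have h10 : -1 < k := by exact_mod_cast h8
    omega
  rw [hk, zpow_zero, one_mul] at h
  exact h

/-! ### Lifts of homeomorphisms of the circle -/

/-- The universal covering `x ↦ exp (2πix)` of the circle. -/
noncomputable def circleProj (x : ℝ) : Circle := Circle.exp (2 * Real.pi * x)

theorem circleProj_eq_iff {x y : ℝ} : circleProj x = circleProj y ↔ ∃ k : ℤ, x = y + k := by
  have hpi : (2 * Real.pi) ≠ 0 := by positivity
  rw [circleProj, circleProj, Circle.exp_eq_exp]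
  refine exists_congr fun k => ⟨fun h => ?_, fun h => ?_⟩
  · apply mul_left_cancel₀ hpi; rw [h]; ring
  · rw [h]; ring

theorem circleProj_add_int (x : ℝ) (k : ℤ) : circleProj (x + k) = circleProj x :=
  circleProj_eq_iff.mpr ⟨k, rfl⟩

theorem circleProj_surjective : Function.Surjective circleProj := by
  intro z
  obtain ⟨t, ht⟩ := Circle.exp_surjective z
  refine ⟨t / (2 * Real.pi), ?_⟩
  rw [circleProj, mul_div_cancel₀ _ (by positivity), ht]

theorem continuous_circleProj : Continuous circleProj := by
  unfold circleProj; fun_prop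

/-- `F` is a lift of the homeomorphism `f` of the circle to the line. -/
def IsLift (F : ℝ ≃o ℝ) (f : Circle ≃ₜ Circle) : Prop := ∀ x, f (circleProj x) = circleProj (F x)

theorem IsLift.one : IsLift 1 1 := fun _ => rfl

theorem IsLift.mul {F G : ℝ ≃o ℝ} {f g : Circle ≃ₜ Circle} (hF : IsLift F f) (hG : IsLift G g) :
    IsLift (F * G) (f * g) := fun x => by
  rw [Homeomorph.mul_apply, hG, hF, RelIso.mul_apply]

theorem IsLift.inv {F : ℝ ≃o ℝ} {f : Circle ≃ₜ Circle} (hF : IsLift F f) : IsLift F⁻¹ f⁻¹ :=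
  fun x => by
    rw [Homeomorph.inv_apply, Homeomorph.symm_apply_eq, hF, RelIso.apply_inv_self]

theorem IsLift.pow {F : ℝ ≃o ℝ} {f : Circle ≃ₜ Circle} (hF : IsLift F f) (n : ℕ) :
    IsLift (F ^ n) (f ^ n) := by
  induction n with
  | zero => exact IsLift.one
  | succ n ih => rw [pow_succ, pow_succ]; exact ih.mul hF

theorem IsLift.zpow_unitShift_mul {F : ℝ ≃o ℝ} {f : Circle ≃ₜ Circle} (hF : IsLift F f) (k : ℤ) :
    IsLift (unitShift ^ k * F) f := fun x => by
  rw [RelIso.mul_apply, unitShift_zpow_apply, circleProj_add_int, hF]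

/-- The difference `F x - x` is continuous and integer valued on a connected space. -/
theorem exists_int_of_circleProj_eq {F : ℝ → ℝ} (hF : Continuous F)
    (h : ∀ x, circleProj (F x) = circleProj x) : ∃ k : ℤ, ∀ x, F x = x + k := by
  have h1 : ∀ x, ∃ k : ℤ, F x = x + k := fun x => circleProj_eq_iff.mp (h x)
  choose k hk using h1
  have hc : Continuous fun x => ((k x : ℤ) : ℝ) := by
    have : (fun x => ((k x : ℤ) : ℝ)) = fun x => F x - x := by
      funext x; rw [hk x]; ring
    rw [this]; exact hF.sub continuous_id
  have hk' : Continuous k := Int.isClosedEmbedding_coe_real.isEmbedding.continuous_iff.mpr hc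
  refine ⟨k 0, fun x => ?_⟩
  rw [hk x, PreconnectedSpace.constant inferInstance hk' (x := x) (y := 0)]

theorem IsLift.eq_zpow_mul {F G : ℝ ≃o ℝ} {f : Circle ≃ₜ Circle} (hF : IsLift F f)
    (hG : IsLift G f) : ∃ k : ℤ, F = unitShift ^ k * G := by
  obtain ⟨k, hk⟩ := exists_int_of_circleProj_eq (F * G⁻¹ : ℝ ≃o ℝ).continuous
    fun x => by rw [← hF.mul hG.inv, mul_inv_cancel]; rfl
  refine ⟨k, RelIso.ext fun x => ?_⟩
  have := hk (G x)
  rw [RelIso.mul_apply, RelIso.inv_apply_self] at this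
  rw [this, RelIso.mul_apply, unitShift_zpow_apply]

/-- `F (x + 1) - F x` is a positive integer. If it exceeded 1, then `F` would take the value `F x +
1` strictly between `x` and `x + 1`, against the injectivity of `f`. -/
theorem IsLift.commute_unitShift {F : ℝ ≃o ℝ} {f : Circle ≃ₜ Circle} (hF : IsLift F f) :
    Commute unitShift F := by
  have key : ∀ x, F (x + 1) = F x + 1 := by
    intro x
    have h1 : circleProj (F (x + 1)) = circleProj (F x) := by
      rw [← hF, ← hF]
      congr 1
      exact_mod_cast circleProj_add_int x 1
    obtain ⟨k, hk⟩ := circleProj_eq_iff.mp h1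
    have h2 : F x < F (x + 1) := F.strictMono (lt_add_one x)
    have hk1 : 1 ≤ k := by
      have : (0 : ℝ) < k := by linarith
      exact_mod_cast this
    by_contra hne
    have hk2 : F x + 1 < F (x + 1) := by
      refine lt_of_le_of_ne ?_ (Ne.symm hne)
      rw [hk]
      have : (1 : ℝ) ≤ k := by exact_mod_cast hk1
      linarith
    obtain ⟨y, hy⟩ := F.surjective (F x + 1)
    have h3 : x < y := F.lt_iff_lt.mp (by rw [hy]; linarith)
    have h4 : y < x + 1 := F.lt_iff_lt.mp (by rw [hy]; exact hk2)
    have h5 : circleProj y = circleProj x := by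
      apply f.injective
      rw [hF, hF, hy]
      exact_mod_cast circleProj_add_int (F x) 1
    obtain ⟨n, hn⟩ := circleProj_eq_iff.mp h5
    have h6 : (0 : ℝ) < n := by linarith
    have h7 : (n : ℝ) < 1 := by linarith
    have h8 : 0 < n := by exact_mod_cast h6
    have h9 : n < 1 := by exact_mod_cast h7
    omega
  exact RelIso.ext fun x => (key x).symm

theorem exists_continuous_lift (f : Circle ≃ₜ Circle) :
    ∃ F : ℝ → ℝ, Continuous F ∧ ∀ x, f (circleProj x) = circleProj (F x) := by
  obtain ⟨e, he⟩ := Circle.exp_surjective (f (circleProj 0))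
  obtain ⟨F, ⟨-, hF⟩, -⟩ := Circle.isCoveringMap_exp.existsUnique_continuousMap_lifts
    (⟨fun x => f (circleProj x), f.continuous.comp continuous_circleProj⟩ : C(ℝ, Circle)) 0 e he
  refine ⟨fun x => F x / (2 * Real.pi), by fun_prop, fun x => ?_⟩
  change _ = Circle.exp (2 * Real.pi * (F x / (2 * Real.pi)))
  rw [mul_div_cancel₀ _ (by positivity)]
  exact (congrFun hF x).symm

/-- The square of a homeomorphism of the circle preserves the orientation, that is, it has an
increasing lift. -/
theorem exists_isLift_sq (f : Circle ≃ₜ Circle) : ∃ F, IsLift F (f ^ 2) := by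
  obtain ⟨F, hFc, hF⟩ := exists_continuous_lift f
  obtain ⟨G, hGc, hG⟩ := exists_continuous_lift f⁻¹
  obtain ⟨k, hk⟩ := exists_int_of_circleProj_eq (hGc.comp hFc) fun x => by
    rw [Function.comp_apply, ← hG, ← hF]; exact f.symm_apply_apply _
  obtain ⟨n, hn⟩ := exists_int_of_circleProj_eq (hFc.comp hGc) fun x => by
    rw [Function.comp_apply, ← hF, ← hG]; exact f.apply_symm_apply _
  have hinj : Function.Injective F := fun x y h => by
    have h1 := hk x
    have h2 := hk y
    simp only [Function.comp_apply, h] at h1 h2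
    linarith
  have hsurj : Function.Surjective F := fun y => ⟨G (y - n), by
    have := hn (y - n)
    simpa using this⟩
  -- `F` may be decreasing, when `f` reverses the orientation; its square is increasing in both
  -- cases.
  have hmono : StrictMono (F ∘ F) := by
    rcases hFc.strictMono_of_inj hinj with h | h
    · exact h.comp h
    · exact h.comp h
  refine ⟨hmono.orderIsoOfSurjective _ (hsurj.comp hsurj), fun x => ?_⟩
  rw [pow_two, Homeomorph.mul_apply, hF, hF]
  rfl

theorem IsLift.towerConj {a c d : ℝ ≃o ℝ} {A C D : Circle ≃ₜ Circle} (ha : IsLift a A)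
    (hc : IsLift c C) (hd : IsLift d D) (i : Fin 3 × Bool) :
    IsLift (towerConj a c d i) (towerConj A C D i) := by
  have hu : IsLift ((a ^ (4 * (i.1 : ℕ)))⁻¹ * (if i.2 then d⁻¹ else 1))
      ((A ^ (4 * (i.1 : ℕ)))⁻¹ * (if i.2 then D⁻¹ else 1)) := by
    refine (ha.pow _).inv.mul ?_
    split_ifs
    exacts [hd.inv, IsLift.one]
  exact (hu.mul hc).mul hu.inv

theorem IsLift.towerProd {a c d : ℝ ≃o ℝ} {A C D : Circle ≃ₜ Circle} (ha : IsLift a A)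
    (hc : IsLift c C) (hd : IsLift d D) : IsLift (towerProd a c d) (towerProd A C D) := by
  have h := ha.towerConj hc hd
  have h2 := fun j => (h (j, true)).mul ((h (j, false)).inv.pow 2)
  exact ((h2 0).mul (h2 1)).mul (h2 2)

/-- In a Klein system of orientation preserving homeomorphisms of the circle, `towerProd A (C ^ 2) D`
has a lift with a fixed point in every gap between fixed points of a lift of `A ^ 6`. -/
theorem KleinSystem.exists_lift {A C D B : Circle ≃ₜ Circle} (h : KleinSystem A C D B)
    {a c d : ℝ ≃o ℝ} (ha : IsLift a A) (hc : IsLift c C) (hd : IsLift d D) :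
    ∃ w, IsLift w (towerProd A (C ^ 2) D) ∧ (∃ x, w x = x) ∧
      ∀ l : ℤ, ∀ p, ∃ x ∈ gapAround {q | (unitShift ^ l * a ^ 6) q = q} p, w x = x := by
  have h1 : IsLift ((a ^ 6)⁻¹ * c * a ^ 6) C⁻¹ := by
    rw [← h.klein_c]; exact ((ha.pow 6).inv.mul hc).mul (ha.pow 6)
  have h2 : IsLift ((a ^ 6)⁻¹ * d * a ^ 6) D⁻¹ := by
    rw [← h.klein_d]; exact ((ha.pow 6).inv.mul hd).mul (ha.pow 6)
  obtain ⟨k, hk⟩ := h1.eq_zpow_mul hc.inv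
  obtain ⟨m, hm⟩ := h2.eq_zpow_mul hd.inv
  have hTa := ha.commute_unitShift
  have hTc := hc.commute_unitShift
  have hTd := hd.commute_unitShift
  set t := unitShift ^ k with ht
  -- The lifted relation inverts `c` only up to the central translation `t`. Squaring turns this
  -- into `t ^ 2`, and dividing by `t` makes the inversion exact; this is why `KleinSystem` involves
  -- `c ^ 2`.
  set c₂ := t⁻¹ * c ^ 2 with hc₂
  have hTc₂ : Commute unitShift c₂ :=
    ((Commute.refl _).zpow_right k).inv_right.mul_right (hTc.pow_right 2)
  have hlift : IsLift c₂ (C ^ 2) := by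
    have := (hc.pow 2).zpow_unitShift_mul (-k)
    rwa [zpow_neg] at this
  -- All lifts of `A ^ 6` act alike by conjugation, so `l` stays free.
  have hconj : ∀ (l : ℤ) (g : ℝ ≃o ℝ), Commute unitShift g →
      (unitShift ^ l * a ^ 6)⁻¹ * g * (unitShift ^ l * a ^ 6) = (a ^ 6)⁻¹ * g * a ^ 6 := by
    intro l g hg
    calc _ = (a ^ 6)⁻¹ * ((unitShift ^ l)⁻¹ * (g * unitShift ^ l)) * a ^ 6 := by
          rw [mul_inv_rev]; simp only [mul_assoc]
      _ = _ := by rw [← (hg.zpow_left l).eq, inv_mul_cancel_left]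
  have htc : Commute t c := hTc.zpow_left k
  have hkl : (a ^ 6)⁻¹ * c₂ * a ^ 6 = c₂⁻¹ := by
    have hta : Commute t (a ^ 6) := (hTa.zpow_left k).pow_right 6
    calc (a ^ 6)⁻¹ * c₂ * a ^ 6 = t⁻¹ * (((a ^ 6)⁻¹ * c * a ^ 6) * ((a ^ 6)⁻¹ * c * a ^ 6)) := by
          rw [hc₂, ← mul_assoc, ← (hta.inv_left.inv_right).eq, pow_two]
          simp only [mul_assoc, mul_inv_cancel_left]
      _ = t⁻¹ * (t * (c⁻¹ * t) * c⁻¹) := by rw [hk]; simp only [mul_assoc]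
      _ = c₂⁻¹ := by
          rw [hc₂, ← htc.inv_right.eq, (htc.inv_left.pow_right 2).eq, pow_two]
          simp only [mul_assoc, mul_inv_rev, inv_inv, inv_mul_cancel_left]
  have hcomm : ∀ i j, Commute (_root_.towerConj a c₂ d i) (_root_.towerConj a c₂ d j) := by
    intro i j
    have hi := ha.towerConj hlift hd i
    have hj := ha.towerConj hlift hd j
    have hij := hi.mul hj
    rw [(h.comm i j).eq] at hij
    obtain ⟨n, hn⟩ := hij.eq_zpow_mul (hj.mul hi)
    -- The lifts commute up to an integer translation, which a fixed point of one of them rules out.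
    obtain ⟨q, -, hq⟩ := exists_fixed_towerConj (l := 0) (s := unitShift ^ (0 : ℤ) * a ^ 6)
      hTa hTd rfl (by rw [hconj 0 _ hTc₂, hkl]) (by rw [hconj 0 _ hTd, hm]) j 0
    exact commute_of_commute_mod_unitShift hj.commute_unitShift hn hq
  refine ⟨towerProd a c₂ d, ha.towerProd hlift hd, ?_, fun l p => ?_⟩
  · exact exists_fixed_towerProd (l := 0) hTa hTc₂ hTd rfl (by rw [hconj 0 _ hTc₂, hkl])
      (by rw [hconj 0 _ hTd, hm]) hcomm
  · exact exists_fixed_towerProd_gapAround hTa hTd rfl (by rw [hconj l _ hTc₂, hkl])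
      (by rw [hconj l _ hTd, hm]) hcomm p

/-- Two opposite Klein systems on the circle are degenerate. -/
theorem pow_six_eq_one_of_kleinSystem {A C D B C' D' : Circle ≃ₜ Circle}
    (h : KleinSystem A C D B) (h' : KleinSystem B C' D' A) {a c d b c' d' : ℝ ≃o ℝ}
    (ha : IsLift a A) (hc : IsLift c C) (hd : IsLift d D) (hb : IsLift b B)
    (hc' : IsLift c' C') (hd' : IsLift d' D') : A ^ 6 = 1 := by
  obtain ⟨w, hw, -, hwgap⟩ := h.exists_lift ha hc hd
  obtain ⟨v, hv, ⟨y, hy⟩, hvgap⟩ := h'.exists_lift hb hc' hd'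
  have hv42 := hv.pow 42
  have hw42 := hw.pow 42
  rw [h'.prod] at hv42
  rw [h.prod] at hw42
  obtain ⟨l, hl⟩ := hv42.eq_zpow_mul (ha.pow 6)
  obtain ⟨n, hn⟩ := hw42.eq_zpow_mul (hb.pow 6)
  have hfv : {q | (unitShift ^ l * a ^ 6) q = q} = {q | v q = q} := by
    ext q; rw [← hl]; exact ⟨fixed_of_pow (by norm_num), fun hq => pow_fixed hq 42⟩
  have hfw : {q | (unitShift ^ n * b ^ 6) q = q} = {q | w q = q} := by
    ext q; rw [← hn]; exact ⟨fixed_of_pow (by norm_num), fun hq => pow_fixed hq 42⟩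
  -- The gap of a fixed point `q` of `w` is just `q`, and `v` has a fixed point in it.
  have hwv : ∀ q, w q = q → v q = q := by
    intro q hq
    obtain ⟨x, hx, hvx⟩ := hvgap n q
    rw [hfw] at hx
    have := hx q hq
    simp only [lt_self_iff_false, iff_false, not_lt] at this
    rwa [le_antisymm this.1 this.2] at hvx
  have hv1 : v = 1 := by
    refine RelIso.ext fun p => ?_
    by_contra hp
    -- This fixed point of `w` is fixed by `v`, yet lies in a gap of the fixed points of `v`.
    obtain ⟨x, hx, hwx⟩ := hwgap l p
    rw [hfv] at hx
    exact disjoint_gapAround (F := {q | v q = q}) hp (hwv x hwx) hx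
  rw [hv1, one_pow] at hv42
  refine Homeomorph.ext fun z => ?_
  obtain ⟨x, rfl⟩ := circleProj_surjective z
  exact hv42 x

/-! ### The planar relations -/

theorem plane_ext {v w : Plane} (h0 : v 0 = w 0) (h1 : v 1 = w 1) : v = w := by
  ext i; fin_cases i
  exacts [h0, h1]

/-- The homeomorphism `(x, y) ↦ (φ x, y + f x)`. -/
noncomputable def skewMap (φ : ℝ ≃ₜ ℝ) (f : C(ℝ, ℝ)) : Plane ≃ₜ Plane where
  toFun w := !₂[φ (w 0), w 1 + f (w 0)]
  invFun w := !₂[φ.symm (w 0), w 1 - f (φ.symm (w 0))]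
  left_inv w := by ext i; fin_cases i <;> simp
  right_inv w := by ext i; fin_cases i <;> simp
  continuous_toFun := by
    refine (PiLp.continuous_toLp 2 _).comp (continuous_pi fun i => ?_)
    fin_cases i <;> simp <;> fun_prop
  continuous_invFun := by
    refine (PiLp.continuous_toLp 2 _).comp (continuous_pi fun i => ?_)
    fin_cases i <;> simp <;> fun_prop

theorem skewMap_apply_zero (φ : ℝ ≃ₜ ℝ) (f : C(ℝ, ℝ)) (w : Plane) :
    skewMap φ f w 0 = φ (w 0) := by simp [skewMap]

theorem skewMap_apply_one (φ : ℝ ≃ₜ ℝ) (f : C(ℝ, ℝ)) (w : Plane) :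
    skewMap φ f w 1 = w 1 + f (w 0) := by simp [skewMap]

theorem skewMap_mul (φ ψ : ℝ ≃ₜ ℝ) (f g : C(ℝ, ℝ)) :
    skewMap φ f * skewMap ψ g = skewMap (φ * ψ) (g + f.comp ψ) := by
  refine Homeomorph.ext fun w => plane_ext ?_ ?_
  · simp only [Homeomorph.mul_apply, skewMap_apply_zero]
  · simp [Homeomorph.mul_apply, skewMap_apply_zero, skewMap_apply_one, add_assoc]

theorem skewMap_one_zero : skewMap 1 0 = 1 :=
  Homeomorph.ext fun w => plane_ext (by simp [skewMap_apply_zero]) (by simp [skewMap_apply_one])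

theorem skewMap_inv (φ : ℝ ≃ₜ ℝ) : (skewMap φ 0)⁻¹ = skewMap φ⁻¹ 0 := by
  rw [inv_eq_iff_mul_eq_one, skewMap_mul, mul_inv_cancel, ← skewMap_one_zero]
  congr 1
  ext x; simp

theorem skewMap_one_mul (f g : C(ℝ, ℝ)) : skewMap 1 f * skewMap 1 g = skewMap 1 (f + g) := by
  rw [skewMap_mul, mul_one]
  congr 1
  ext x; simp [add_comm]

theorem skewMap_one_inv (f : C(ℝ, ℝ)) : (skewMap 1 f)⁻¹ = skewMap 1 (-f) := by
  rw [inv_eq_iff_mul_eq_one, skewMap_one_mul, add_neg_cancel, skewMap_one_zero]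

theorem skewMap_one_pow (f : C(ℝ, ℝ)) (n : ℕ) : skewMap 1 f ^ n = skewMap 1 (n • f) := by
  induction n with
  | zero => rw [pow_zero, zero_smul, skewMap_one_zero]
  | succ n ih => rw [pow_succ, ih, skewMap_one_mul, succ_nsmul]

/-- This reduces the planar relations to identities between functions of `x`. -/
theorem skewMap_conj (φ : ℝ ≃ₜ ℝ) (f : C(ℝ, ℝ)) :
    skewMap φ 0 * skewMap 1 f * (skewMap φ 0)⁻¹ = skewMap 1 (f.comp (φ⁻¹ : ℝ ≃ₜ ℝ)) := by
  rw [skewMap_inv, skewMap_mul, skewMap_mul, mul_one, mul_inv_cancel]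
  congr 1
  ext x; simp

theorem skewMap_mul_zero (φ ψ : ℝ ≃ₜ ℝ) : skewMap φ 0 * skewMap ψ 0 = skewMap (φ * ψ) 0 := by
  rw [skewMap_mul]
  congr 1
  ext x; simp

theorem skewMap_pow_zero (φ : ℝ ≃ₜ ℝ) (n : ℕ) : skewMap φ 0 ^ n = skewMap (φ ^ n) 0 := by
  induction n with
  | zero => rw [pow_zero, pow_zero, skewMap_one_zero]
  | succ n ih => rw [pow_succ, ih, skewMap_mul_zero, pow_succ]

/-- The function `gamma0` as a continuous map. -/
noncomputable def gamma0Map : C(ℝ, ℝ) := ⟨gamma0, continuous_gamma0⟩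

theorem translateX_eq (t : ℝ) : translateX t = skewMap (Homeomorph.addRight t) 0 :=
  Homeomorph.ext fun w => plane_ext (by simp [skewMap, translateX])
    (by simp [skewMap, translateX])

theorem translateY_eq (t : ℝ) : translateY t = skewMap 1 (.const ℝ t) :=
  Homeomorph.ext fun w => plane_ext (by simp [skewMap, translateY])
    (by simp [skewMap, translateY])

theorem shear_eq (t : ℝ) : shear t = skewMap 1 (t • gamma0Map) :=
  Homeomorph.ext fun w => plane_ext (by simp [skewMap, shear])
    (by simp [skewMap, shear, gamma0Map])

theorem deltaMap_eq : deltaMap = skewMap delta0 0 :=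
  Homeomorph.ext fun w => plane_ext (by simp [skewMap, deltaMap])
    (by simp [skewMap, deltaMap])

theorem addRight_pow_apply (t : ℝ) (n : ℕ) (x : ℝ) :
    ((Homeomorph.addRight t : ℝ ≃ₜ ℝ) ^ n) x = x + n * t := by
  induction n generalizing x with
  | zero => simp
  | succ n ih =>
    rw [pow_succ, Homeomorph.mul_apply, ih, Homeomorph.coe_addRight]
    push_cast; ring

theorem gamma0_add_one (x : ℝ) : gamma0 (x + 1) = gamma0 x := by
  rw [gamma0, gamma0, Int.fract_add_one]

theorem delta0_add_one (x : ℝ) : delta0 (x + 1) = delta0 x + 1 := by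
  change ((⌊x + 1⌋ : ℤ) : ℝ) + delta0Period (Int.fract (x + 1)) =
    ((⌊x⌋ : ℤ) : ℝ) + delta0Period (Int.fract x) + 1
  rw [Int.fract_add_one, Int.floor_add_one]
  push_cast; ring

theorem gamma0_of_mem {x : ℝ} (h0 : 0 ≤ x) (h1 : x < 1) : gamma0 x = gamma0Period x := by
  rw [gamma0, Int.fract_eq_self.mpr ⟨h0, h1⟩]

theorem delta0_of_mem {x : ℝ} (h0 : 0 ≤ x) (h1 : x < 1) : delta0 x = delta0Period x := by
  have hf := floor_add_of_mem (n := 0) h0 h1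
  simp only [Int.cast_zero, zero_add] at hf
  change ((⌊x⌋ : ℤ) : ℝ) + delta0Period (Int.fract x) = _
  rw [hf.1, hf.2]
  simp

theorem gamma0_add_half (x : ℝ) : gamma0 (x + 1 / 2) = -gamma0 x := by
  have h0 := Int.fract_nonneg x
  have h1 := Int.fract_lt_one x
  have hx := Int.floor_add_fract x
  have hg : gamma0 (x + 1 / 2) = gamma0 (Int.fract x + 1 / 2) := by
    rw [gamma0, gamma0]
    conv_lhs => rw [← hx, add_assoc, Int.fract_intCast_add]
  have hg' : gamma0 x = gamma0Period (Int.fract x) := rfl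
  rw [hg, hg']
  by_cases h : Int.fract x < 1 / 2
  · rw [gamma0_of_mem (by linarith) (by linarith)]
    unfold gamma0Period
    split_ifs <;> linarith
  · rw [show Int.fract x + 1 / 2 = (Int.fract x - 1 / 2) + 1 by ring, gamma0_add_one,
      gamma0_of_mem (by linarith) (by linarith)]
    unfold gamma0Period
    split_ifs <;> linarith

/-! ### The planar Klein system -/

/-- The difference between the pull-back of `gamma0` by `delta0` and twice `gamma0`. -/
noncomputable def gammaDefect (x : ℝ) : ℝ := gamma0 (delta0 x) - 2 * gamma0 x

theorem gammaDefect_add_one (x : ℝ) : gammaDefect (x + 1) = gammaDefect x := by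
  rw [gammaDefect, delta0_add_one, gamma0_add_one, gamma0_add_one, gammaDefect]

theorem gammaDefect_of_mem {x : ℝ} (h0 : 0 ≤ x) (h1 : x < 1) :
    gammaDefect x = if x < 1 / 3 then -1 + 6 * x else if x < 2 / 3 then 1 else 5 - 6 * x := by
  have h2 : 0 ≤ delta0Period x := by unfold delta0Period; split_ifs <;> linarith
  have h3 : delta0Period x < 1 := by unfold delta0Period; split_ifs <;> linarith
  rw [gammaDefect, delta0_of_mem h0 h1, gamma0_of_mem h0 h1, gamma0_of_mem h2 h3]
  unfold gamma0Period delta0Period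
  split_ifs <;> linarith

/-- On each third of the period exactly one term is the constant 1, and the other two are affine
with opposite slopes and cancel. -/
theorem sum_gammaDefect (x : ℝ) :
    gammaDefect x + gammaDefect (x + 1 / 3) + gammaDefect (x + 2 / 3) = 1 := by
  have hper : Function.Periodic gammaDefect 1 := gammaDefect_add_one
  have hred : ∀ t, gammaDefect (x + t) = gammaDefect (Int.fract x + t) := by
    intro t
    have := hper.int_mul ⌊x⌋ (Int.fract x + t)
    rw [← this]
    congr 1
    linarith [Int.floor_add_fract x]
  have h0 := Int.fract_nonneg x
  have h1 := Int.fract_lt_one x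
  rw [hred, hred, show gammaDefect x = gammaDefect (Int.fract x) by simpa using hred 0]
  set u := Int.fract x
  rcases lt_or_ge u (1 / 3) with h | h
  · rw [gammaDefect_of_mem h0 h1, gammaDefect_of_mem (by linarith) (by linarith),
      gammaDefect_of_mem (by linarith) (by linarith)]
    split_ifs <;> linarith
  · rcases lt_or_ge u (2 / 3) with h' | h'
    · rw [show u + 2 / 3 = (u - 1 / 3) + 1 by ring, gammaDefect_add_one, gammaDefect_of_mem h0 h1,
        gammaDefect_of_mem (by linarith) (by linarith),
        gammaDefect_of_mem (by linarith) (by linarith)]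
      split_ifs <;> linarith
    · rw [show u + 2 / 3 = (u - 1 / 3) + 1 by ring, show u + 1 / 3 = (u - 2 / 3) + 1 by ring,
        gammaDefect_add_one, gammaDefect_add_one, gammaDefect_of_mem h0 h1,
        gammaDefect_of_mem (by linarith) (by linarith),
        gammaDefect_of_mem (by linarith) (by linarith)]
      split_ifs <;> linarith

theorem towerConj_skewMap (α φ : ℝ ≃ₜ ℝ) (f : C(ℝ, ℝ)) (i : Fin 3 × Bool) :
    towerConj (skewMap α 0) (skewMap 1 f) (skewMap φ 0) i =
      skewMap 1 (f.comp ((if i.2 then φ else 1) * α ^ (4 * (i.1 : ℕ)) : ℝ ≃ₜ ℝ)) := by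
  have hu : (skewMap α 0 ^ (4 * (i.1 : ℕ)))⁻¹ * (if i.2 then (skewMap φ 0)⁻¹ else 1) =
      skewMap ((α ^ (4 * (i.1 : ℕ)))⁻¹ * (if i.2 then φ⁻¹ else 1)) 0 := by
    rw [skewMap_pow_zero, skewMap_inv, ← skewMap_mul_zero]
    congr 1
    split_ifs
    exacts [skewMap_inv φ, skewMap_one_zero.symm]
  rw [towerConj, hu, skewMap_conj, mul_inv_rev, inv_inv]
  congr 3
  by_cases h : i.2 = true
  · rw [if_pos h, if_pos h, inv_inv]
  · rw [if_neg h, if_neg h, inv_one]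

theorem kleinSystem_translateX :
    KleinSystem (translateX (1 / 12)) (shear (1 / 168)) deltaMap (translateY (1 / 12)) := by
  rw [translateX_eq, shear_eq, deltaMap_eq, translateY_eq]
  refine ⟨?_, ?_, fun i j => ?_, ?_⟩
  · have := skewMap_conj ((Homeomorph.addRight (1 / 12 : ℝ)) ^ 6)⁻¹ ((1 / 168 : ℝ) • gamma0Map)
    rw [← skewMap_inv, ← skewMap_pow_zero, inv_inv] at this
    rw [this, skewMap_one_inv]
    congr 1
    ext x
    simp only [ContinuousMap.comp_apply, inv_inv, ContinuousMap.smul_apply,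
      ContinuousMap.neg_apply, addRight_pow_apply, gamma0Map, ContinuousMap.coe_mk]
    rw [show x + ((6 : ℕ) : ℝ) * (1 / 12) = x + 1 / 2 by push_cast; ring, gamma0_add_half, smul_neg]
  · rw [skewMap_pow_zero, skewMap_inv, skewMap_inv, skewMap_mul_zero, skewMap_mul_zero]
    congr 1
    rw [mul_assoc, inv_mul_eq_iff_eq_mul]
    refine Homeomorph.ext fun x => ?_
    rw [Homeomorph.mul_apply, Homeomorph.mul_apply, addRight_pow_apply, addRight_pow_apply,
      Homeomorph.inv_apply, show ((6 : ℕ) : ℝ) * (1 / 12) = 1 / 2 by push_cast; norm_num,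
      delta0_add_half]
  · rw [skewMap_one_pow, towerConj_skewMap, towerConj_skewMap, commute_iff_eq, skewMap_one_mul,
      skewMap_one_mul, add_comm]
  -- By `sum_gammaDefect` the product is the vertical translation by 2/168, and 42 times this is 1/2
  -- = 6/12.
  · simp only [towerProd, skewMap_one_pow, towerConj_skewMap, skewMap_one_inv, skewMap_one_mul]
    congr 1
    ext x
    have h := sum_gammaDefect x
    simp only [gammaDefect] at h
    have e0 : ∀ y : ℝ, y + ((4 * ((0 : Fin 3) : ℕ) : ℕ) : ℝ) * (1 / 12) = y := by simp
    have e1 : ∀ y : ℝ, y + ((4 * ((1 : Fin 3) : ℕ) : ℕ) : ℝ) * (1 / 12) = y + 1 / 3 := by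
      intro y; norm_num
    have e2 : ∀ y : ℝ, y + ((4 * ((2 : Fin 3) : ℕ) : ℕ) : ℝ) * (1 / 12) = y + 2 / 3 := by
      intro y; norm_num
    simp only [ContinuousMap.smul_apply, ContinuousMap.add_apply, ContinuousMap.neg_apply,
      ContinuousMap.comp_apply, Homeomorph.mul_apply, addRight_pow_apply,
      if_true, Bool.false_eq_true, if_false, Homeomorph.one_apply, gamma0Map,
      ContinuousMap.coe_mk, ContinuousMap.const_apply, e0, e1, e2]
    simp only [nsmul_eq_mul, smul_eq_mul]
    push_cast
    linarith

/-! ### Transfer of the relations to the disk -/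

/-- The homeomorphisms of the plane with bounded displacement. -/
def boundedHomeo : Subgroup (Plane ≃ₜ Plane) where
  carrier := {f | BoundedDisplacement f}
  one_mem' := ⟨0, fun w => by simp⟩
  mul_mem' := by
    rintro f g ⟨C, hC⟩ ⟨C', hC'⟩
    refine ⟨C + C', fun w => ?_⟩
    rw [Homeomorph.mul_apply, ← sub_add_sub_cancel _ (g w)]
    exact (norm_add_le _ _).trans (add_le_add (hC _) (hC' _))
  inv_mem' := fun hf => hf.symm

/-- The embedding of the group of homeomorphisms with bounded displacement in `Homeo(D, ∂D)`. -/
noncomputable def diskHom : boundedHomeo →* homeoDiskRelBoundary :=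
  MonoidHom.mk' (fun f => toHomeoDisk f.1 f.2) fun f g => by
    refine Subtype.ext (Homeomorph.ext fun z => Subtype.ext ?_)
    change diskMap (f.1 * g.1) z = diskMap f.1 (diskMap g.1 z)
    by_cases hz : ‖(z : Plane)‖ < 1
    · rw [diskMap_of_lt _ hz, diskMap_of_lt _ hz, diskMap_of_lt _ (norm_toDisk_lt _),
        ofDisk_toDisk, Homeomorph.mul_apply]
    · rw [diskMap_of_not_lt _ hz, diskMap_of_not_lt _ hz, diskMap_of_not_lt _ hz]

theorem diskHom_injective : Function.Injective diskHom := by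
  intro f g h
  refine Subtype.ext (Homeomorph.ext fun w => ?_)
  have h1 := congrArg (fun k : homeoDiskRelBoundary =>
    ((k.1 ⟨toDisk w, mem_closedBall_zero_iff.mpr (norm_toDisk_lt w).le⟩ : Disk) : Plane)) h
  change diskMap f.1 (toDisk w) = diskMap g.1 (toDisk w) at h1
  rw [diskMap_of_lt _ (norm_toDisk_lt _), diskMap_of_lt _ (norm_toDisk_lt _), ofDisk_toDisk] at h1
  have h2 := congrArg ofDisk h1
  rwa [ofDisk_toDisk, ofDisk_toDisk] at h2

/-- The planar generators as elements of the group of homeomorphisms with bounded displacement. -/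
noncomputable def boundedGenerator (i : Fin 6) : boundedHomeo :=
  ⟨planarGenerator i, boundedDisplacement_planarGenerator i⟩

theorem diskHom_boundedGenerator (i : Fin 6) : diskHom (boundedGenerator i) = diskGenerator i := rfl

theorem swapMap_mul_self : swapMap * swapMap = 1 :=
  Homeomorph.ext fun w => plane_ext (by simp [swapMap, Homeomorph.mul_apply])
    (by simp [swapMap, Homeomorph.mul_apply])

theorem conj_swapMap (f : Plane ≃ₜ Plane) : MulAut.conj swapMap f = swapMap * f * swapMap := by
  rw [MulAut.conj_apply, inv_eq_of_mul_eq_one_right swapMap_mul_self]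

theorem swapMap_translateX (t : ℝ) : swapMap * translateX t * swapMap = translateY t :=
  Homeomorph.ext fun w => plane_ext (by simp [swapMap, translateX, translateY, Homeomorph.mul_apply])
    (by simp [swapMap, translateX, translateY, Homeomorph.mul_apply])

theorem swapMap_translateY (t : ℝ) : swapMap * translateY t * swapMap = translateX t :=
  Homeomorph.ext fun w => plane_ext (by simp [swapMap, translateX, translateY, Homeomorph.mul_apply])
    (by simp [swapMap, translateX, translateY, Homeomorph.mul_apply])

theorem kleinSystem_diskGenerator :
    KleinSystem (diskGenerator 0) (diskGenerator 2) (diskGenerator 3) (diskGenerator 1) :=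
  (KleinSystem.of_map boundedHomeo.subtype Subtype.val_injective (a := boundedGenerator 0)
    (c := boundedGenerator 2) (d := boundedGenerator 3) (b := boundedGenerator 1)
    kleinSystem_translateX).map diskHom

/-- The coordinate exchange has unbounded displacement, so the conjugation takes place among all
plane homeomorphisms, and the relations are then pulled back to `boundedHomeo`. -/
theorem kleinSystem_diskGenerator_swap :
    KleinSystem (diskGenerator 1) (diskGenerator 4) (diskGenerator 5) (diskGenerator 0) := by
  have h := kleinSystem_translateX.map (MulAut.conj swapMap).toMonoidHom
  simp only [MulEquiv.toMonoidHom_eq_coe, MonoidHom.coe_coe, conj_swapMap, swapMap_translateX,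
    swapMap_translateY] at h
  exact (KleinSystem.of_map boundedHomeo.subtype Subtype.val_injective (a := boundedGenerator 1)
    (c := boundedGenerator 4) (d := boundedGenerator 5) (b := boundedGenerator 0) h).map diskHom

theorem diskGenerator_zero_pow_six_ne_one : diskGenerator 0 ^ 6 ≠ 1 := by
  intro h
  have h1 : boundedGenerator 0 ^ 6 = 1 := diskHom_injective (by rw [map_pow, map_one]; exact h)
  have h2 : translateX (1 / 12) ^ 6 = 1 := congrArg boundedHomeo.subtype h1
  rw [translateX_eq, skewMap_pow_zero] at h2
  have h3 := congrArg (fun f : Plane ≃ₜ Plane => f 0 0) h2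
  simp only [skewMap_apply_zero, addRight_pow_apply] at h3
  norm_num at h3

/-! ### Square roots -/

/-- The interval `[p, f p)` is a fundamental domain for `f` on `(l, r)`: `k` is affine from `[0, 1)`
onto it and is extended equivariantly. Continuity is not needed, as a strictly monotone bijection
onto an interval is enough. -/
theorem exists_translation_coordinate {f : ℝ ≃o ℝ} {l r : ℝ} (hlr : l < r) (hl : f l = l)
    (hr : f r = r) (hf : ∀ x ∈ Set.Ioo l r, x < f x) :
    ∃ k : ℝ → ℝ, StrictMono k ∧ Set.range k = Set.Ioo l r ∧ ∀ t, k (t + 1) = f (k t) := by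
  set p := (l + r) / 2 with hp
  have hpI : p ∈ Set.Ioo l r := ⟨by rw [hp]; linarith, by rw [hp]; linarith⟩
  have hfp : 0 < f p - p := sub_pos.mpr (hf p hpI)
  have hfix : ∀ (n : ℤ) (q : ℝ), f q = q → (f ^ n) q = q := by
    intro n q hq
    induction n with
    | zero => rfl
    | succ n ih => rw [zpow_add_one, RelIso.mul_apply, hq, ih]
    | pred n ih => rw [zpow_sub_one, RelIso.mul_apply, apply_inv_fixed hq, ih]
  have hmem : ∀ (n : ℤ), ∀ x ∈ Set.Ioo l r, (f ^ n) x ∈ Set.Ioo l r := fun n x hx =>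
    ⟨by rw [← hfix n l hl]; exact (f ^ n).strictMono hx.1,
      by rw [← hfix n r hr]; exact (f ^ n).strictMono hx.2⟩
  have hstep : ∀ (n : ℤ) (x : ℝ), (f ^ (n + 1)) x = (f ^ n) (f x) := fun n x => by
    rw [zpow_add_one, RelIso.mul_apply]
  have hmono : StrictMono fun n : ℤ => (f ^ n) p := strictMono_int_of_lt_succ fun n => by
    rw [hstep]; exact (f ^ n).strictMono (hf p hpI)
  set u : ℝ → ℝ := fun t => p + Int.fract t * (f p - p) with hu
  have hu0 : ∀ t, p ≤ u t := fun t =>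
    le_add_of_nonneg_right (mul_nonneg (Int.fract_nonneg t) hfp.le)
  have hu1 : ∀ t, u t < f p := fun t => by
    have := mul_lt_mul_of_pos_right (Int.fract_lt_one t) hfp
    simp only [hu]; linarith
  refine ⟨fun t => (f ^ ⌊t⌋) (u t), fun s t hst => ?_, ?_, fun t => ?_⟩
  · rcases (Int.floor_mono hst.le).eq_or_lt with h | h
    · change (f ^ ⌊s⌋) (u s) < (f ^ ⌊t⌋) (u t)
      rw [h]
      refine (f ^ ⌊t⌋).strictMono (add_lt_add_right (mul_lt_mul_of_pos_right ?_ hfp) p)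
      rw [Int.fract, Int.fract, h]; linarith
    · calc (f ^ ⌊s⌋) (u s) < (f ^ ⌊s⌋) (f p) := (f ^ ⌊s⌋).strictMono (hu1 s)
        _ = (f ^ (⌊s⌋ + 1)) p := (hstep _ _).symm
        _ ≤ (f ^ ⌊t⌋) p := hmono.monotone h
        _ ≤ (f ^ ⌊t⌋) (u t) := (f ^ ⌊t⌋).monotone (hu0 t)
  · ext x
    constructor
    · rintro ⟨t, rfl⟩
      refine hmem _ _ ⟨hpI.1.trans_le (hu0 t), (hu1 t).trans ?_⟩
      have := f.strictMono hpI.2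
      rwa [hr] at this
    · intro hx
      have hne : ∀ y ∈ Set.Ioo l r, f y ≠ y := fun y hy => (hf y hy).ne'
      obtain ⟨m, hm⟩ := exists_le_zpow_apply Set.ordConnected_Ioo hne hx hpI
      obtain ⟨n, hn⟩ := exists_le_zpow_apply Set.ordConnected_Ioo hne hpI hx
      have hn' : (f ^ (-n)) p ≤ x := by
        have := (f ^ (-n) : ℝ ≃o ℝ).monotone hn
        rwa [← RelIso.mul_apply, ← zpow_add, neg_add_cancel, zpow_zero, RelIso.one_apply] at this
      obtain ⟨j, hj, hjmax⟩ := Int.exists_greatest_of_bdd (P := fun j => (f ^ j) p ≤ x)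
        ⟨m, fun z hz => hmono.le_iff_le.mp (hz.trans hm)⟩ ⟨-n, hn'⟩
      have hj1 : x < (f ^ (j + 1)) p := by
        by_contra! hcon
        have := hjmax _ hcon
        omega
      obtain ⟨y, hy⟩ := (f ^ j).surjective x
      have hpy : p ≤ y := by rwa [← (f ^ j).le_iff_le, hy]
      have hyp : y < f p := by rwa [← (f ^ j).lt_iff_lt, hy, ← hstep]
      have hfl := floor_add_of_mem (n := j) (u := (y - p) / (f p - p))
        (div_nonneg (by linarith) hfp.le) ((div_lt_one hfp).mpr (by linarith))
      refine ⟨j + (y - p) / (f p - p), ?_⟩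
      simp only [hu, hfl.1, hfl.2]
      rw [div_mul_cancel₀ _ hfp.ne', add_sub_cancel, hy]
  · simp only [hu, Int.floor_add_one, Int.fract_add_one]
    rw [add_comm ⌊t⌋ 1, zpow_add, zpow_one, RelIso.mul_apply]

/-- An increasing homeomorphism of the line that moves all points of an invariant interval to the
right has a square root on this interval, supported there. -/
theorem exists_root_Ioo {f : ℝ ≃o ℝ} {l r : ℝ} (hlr : l < r) (hl : f l = l)
    (hr : f r = r) (hf : ∀ x ∈ Set.Ioo l r, x < f x) :
    ∃ s : ℝ ≃o ℝ, (∀ x ∉ Set.Ioo l r, s x = x) ∧ ∀ x ∈ Set.Ioo l r, s (s x) = f x := by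
  classical
  obtain ⟨k, hk, hran, hk1⟩ := exists_translation_coordinate hlr hl hr hf
  -- In the coordinate `k` the map `f` is the unit translation, so translation by 1/2 is a root.
  set s : ℝ → ℝ := fun x => if x ∈ Set.Ioo l r then k (Function.invFun k x + 1 / 2) else x with hs
  have hkm : ∀ t, k t ∈ Set.Ioo l r := fun t => hran ▸ Set.mem_range_self t
  have hex : ∀ x ∈ Set.Ioo l r, ∃ t, k t = x := fun x hx => by rwa [← hran] at hx
  have hsk : ∀ t, s (k t) = k (t + 1 / 2) := fun t => by
    simp only [hs]
    rw [if_pos (hkm t), Function.leftInverse_invFun hk.injective]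
  have hout : ∀ x ∉ Set.Ioo l r, s x = x := fun x hx => if_neg hx
  have hmono : StrictMono s := by
    intro x y hxy
    by_cases hx : x ∈ Set.Ioo l r <;> by_cases hy : y ∈ Set.Ioo l r
    · obtain ⟨a, rfl⟩ := hex x hx
      obtain ⟨b, rfl⟩ := hex y hy
      rw [hsk, hsk]
      exact hk (by linarith [hk.lt_iff_lt.mp hxy])
    · obtain ⟨a, rfl⟩ := hex x hx
      rw [hsk, hout y hy]
      refine (hkm _).2.trans_le ?_
      by_contra! h
      exact hy ⟨hx.1.trans hxy, h⟩
    · obtain ⟨b, rfl⟩ := hex y hy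
      rw [hsk, hout x hx]
      refine lt_of_le_of_lt ?_ (hkm _).1
      by_contra! h
      exact hx ⟨h, hxy.trans hy.2⟩
    · rwa [hout x hx, hout y hy]
  have hsurj : Function.Surjective s := by
    intro y
    by_cases hy : y ∈ Set.Ioo l r
    · obtain ⟨b, rfl⟩ := hex y hy
      exact ⟨k (b - 1 / 2), by rw [hsk, sub_add_cancel]⟩
    · exact ⟨y, hout y hy⟩
  refine ⟨hmono.orderIsoOfSurjective s hsurj, hout, fun x hx => ?_⟩
  obtain ⟨t, rfl⟩ := hex x hx
  change s (s (k t)) = _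
  rw [hsk, hsk, ← hk1]
  congr 1
  ring

/-- The homeomorphism of the line that commutes with `x ↦ x + 1` and is `g` on `[0, 1]`. -/
noncomputable def periodize (g : ℝ ≃o ℝ) (h0 : g 0 = 0) (h1 : g 1 = 1) : ℝ ≃ₜ ℝ :=
  have hmem : ∀ f : ℝ ≃o ℝ, f 0 = 0 → f 1 = 1 → ∀ x, 0 ≤ f (Int.fract x) ∧ f (Int.fract x) < 1 :=
    fun f h0 h1 x => ⟨by rw [← h0]; exact f.monotone (Int.fract_nonneg x),
      by rw [← h1]; exact f.strictMono (Int.fract_lt_one x)⟩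
  OrderIso.toHomeomorph (StrictMono.orderIsoOfRightInverse
    (fun x => ⌊x⌋ + g (Int.fract x))
    (fun x y hxy => by
      have hx := hmem g h0 h1 x
      have hy := hmem g h0 h1 y
      rcases (Int.floor_mono hxy.le).eq_or_lt with h | h
      · dsimp only
        rw [h]
        refine add_lt_add_right (g.strictMono ?_) _
        rw [Int.fract, Int.fract, h]; linarith
      · have : ((⌊x⌋ : ℤ) : ℝ) + 1 ≤ ⌊y⌋ := by exact_mod_cast h
        dsimp only
        linarith)
    (fun x => ⌊x⌋ + g⁻¹ (Int.fract x))
    (fun x => by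
      have hx := hmem g⁻¹ (apply_inv_fixed h0) (apply_inv_fixed h1) x
      have := floor_add_of_mem (n := ⌊x⌋) hx.1 hx.2
      dsimp only
      rw [this.1, this.2, RelIso.apply_inv_self, Int.floor_add_fract]))

theorem periodize_apply (g : ℝ ≃o ℝ) (h0 : g 0 = 0) (h1 : g 1 = 1) (x : ℝ) :
    periodize g h0 h1 x = ⌊x⌋ + g (Int.fract x) := rfl

theorem fract_apply_mem {g : ℝ ≃o ℝ} (h0 : g 0 = 0) (h1 : g 1 = 1) (x : ℝ) :
    0 ≤ g (Int.fract x) ∧ g (Int.fract x) < 1 :=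
  ⟨by rw [← h0]; exact g.monotone (Int.fract_nonneg x),
    by rw [← h1]; exact g.strictMono (Int.fract_lt_one x)⟩

theorem periodize_periodize (g : ℝ ≃o ℝ) (h0 : g 0 = 0) (h1 : g 1 = 1) (x : ℝ) :
    periodize g h0 h1 (periodize g h0 h1 x) = ⌊x⌋ + g (g (Int.fract x)) := by
  have hx := fract_apply_mem h0 h1 x
  have := floor_add_of_mem (n := ⌊x⌋) hx.1 hx.2
  rw [periodize_apply, periodize_apply, this.1, this.2]

theorem abs_periodize_sub_le (g : ℝ ≃o ℝ) (h0 : g 0 = 0) (h1 : g 1 = 1) (x : ℝ) :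
    |periodize g h0 h1 x - x| ≤ 1 := by
  have hx := fract_apply_mem h0 h1 x
  rw [periodize_apply, abs_le]
  constructor <;> linarith [Int.floor_add_fract x, Int.fract_nonneg x, Int.fract_lt_one x]

theorem delta0_half : delta0 (1 / 2) = 1 / 2 := by
  rw [delta0_of_mem (by norm_num) (by norm_num), delta0Period]; norm_num

theorem delta0_zero : delta0 0 = 0 := by
  rw [delta0_of_mem le_rfl one_pos, delta0Period]; norm_num

theorem delta0_one : delta0 1 = 1 := by
  have := delta0_add_one 0
  rwa [delta0_zero, zero_add] at this

theorem strictMono_delta0 : StrictMono delta0 := by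
  refine (delta0.continuous.strictMono_of_inj delta0.injective).resolve_right fun h => ?_
  have := h (one_pos (α := ℝ))
  rw [delta0_zero, delta0_one] at this
  linarith

/-- There is a square root of `delta0` with bounded displacement. -/
theorem exists_root_delta0 : ∃ σ : ℝ ≃ₜ ℝ, σ * σ = delta0 ∧ ∀ x, |σ x - x| ≤ 1 := by
  set f : ℝ ≃o ℝ := strictMono_delta0.orderIsoOfSurjective _ delta0.surjective
  have hfd : ∀ x, f x = delta0 x := fun _ => rfl
  have hf0 : f 0 = 0 := delta0_zero
  have hfh : f (1 / 2) = 1 / 2 := delta0_half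
  have hf1 : f 1 = 1 := delta0_one
  -- On `(0, 1/2)` the map `δ₀` moves points to the left, so the root is taken for its inverse and
  -- then inverted; on `(1/2, 1)` it moves them to the right. The two roots have disjoint supports.
  obtain ⟨s, hs, hss⟩ := exists_root_Ioo (f := f⁻¹) (l := 0) (r := 1 / 2) (by norm_num)
    (apply_inv_fixed hf0) (apply_inv_fixed hfh) fun x hx => by
      rw [← f.lt_iff_lt, RelIso.apply_inv_self, hfd,
        delta0_of_mem hx.1.le (hx.2.trans (by norm_num)), delta0Period]
      have := hx.1
      have := hx.2
      split_ifs <;> linarith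
  obtain ⟨t, ht, htt⟩ := exists_root_Ioo (f := f) (l := 1 / 2) (r := 1) (by norm_num) hfh hf1
    fun x hx => by
      have h0 := hx.1
      have h1 := hx.2
      rw [hfd, delta0_of_mem (by linarith) hx.2, delta0Period]
      split_ifs <;> linarith
  have hs' : ∀ x ∉ Set.Ioo (0 : ℝ) (1 / 2), s⁻¹ x = x := fun x hx => apply_inv_fixed (hs x hx)
  have hg : ∀ x, 0 ≤ x → x < 1 → (s⁻¹ * t) ((s⁻¹ * t) x) = f x := by
    intro x h0 h1
    simp only [RelIso.mul_apply]
    rcases lt_trichotomy x (1 / 2) with h | rfl | h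
    · have hle : s⁻¹ x < 1 / 2 := by
        rw [← hs' (1 / 2) (by simp)]; exact (s⁻¹ : ℝ ≃o ℝ).strictMono h
      rw [ht x fun h' => by linarith [h'.1], ht _ fun h' => by linarith [h'.1]]
      rcases h0.eq_or_lt with rfl | h0
      · rw [hs' 0 (by simp), hs' 0 (by simp), hf0]
      · have hpos : 0 < f x := by rw [← hf0]; exact f.strictMono h0
        have hlt : f x < 1 / 2 := by rw [← hfh]; exact f.strictMono h
        have := hss (f x) ⟨hpos, hlt⟩
        rw [RelIso.inv_apply_self] at this
        conv_lhs => rw [← this]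
        rw [RelIso.inv_apply_self, RelIso.inv_apply_self]
    · rw [ht (1 / 2) (by simp), hs' (1 / 2) (by simp), ht (1 / 2) (by simp), hs' (1 / 2) (by simp),
        hfh]
    · have htx : 1 / 2 < t x := by
        rw [← ht (1 / 2) (by simp)]; exact t.strictMono h
      rw [hs' (t x) fun h' => by linarith [h'.2], htt x ⟨h, h1⟩, hs']
      intro h'
      have : 1 / 2 < f x := by rw [← hfh]; exact f.strictMono h
      linarith [h'.2]
  have h0 : (s⁻¹ * t) 0 = 0 := by
    rw [RelIso.mul_apply, ht 0 (by norm_num), hs' 0 (by simp)]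
  have h1 : (s⁻¹ * t) 1 = 1 := by
    rw [RelIso.mul_apply, ht 1 (by simp), hs' 1 (by norm_num)]
  refine ⟨periodize _ h0 h1, Homeomorph.ext fun x => ?_, abs_periodize_sub_le _ h0 h1⟩
  rw [Homeomorph.mul_apply, periodize_periodize, hg _ (Int.fract_nonneg x) (Int.fract_lt_one x),
    hfd, delta0_of_mem (Int.fract_nonneg x) (Int.fract_lt_one x)]
  rfl

/-! ### Roots of the six generators with bounded displacement -/

theorem boundedDisplacement_skewMap {φ : ℝ ≃ₜ ℝ} {f : C(ℝ, ℝ)} {M N : ℝ}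
    (hφ : ∀ x, |φ x - x| ≤ M) (hf : ∀ x, |f x| ≤ N) : BoundedDisplacement (skewMap φ f) := by
  refine ⟨M + N, fun w => ?_⟩
  have hv : ∀ v : Plane, ‖v‖ ≤ |v 0| + |v 1| := by
    intro v
    rw [EuclideanSpace.norm_eq, Fin.sum_univ_two]
    refine Real.sqrt_le_iff.mpr ⟨by positivity, ?_⟩
    simp only [Real.norm_eq_abs]
    nlinarith [abs_nonneg (v 0), abs_nonneg (v 1)]
  refine (hv _).trans (add_le_add ?_ ?_)
  · simpa [skewMap_apply_zero] using hφ (w 0)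
  · simpa [skewMap_apply_one] using hf (w 0)

theorem boundedDisplacement_swap_conj {f : Plane ≃ₜ Plane} (hf : BoundedDisplacement f) :
    BoundedDisplacement (swapMap * f * swapMap) := by
  obtain ⟨C, hC⟩ := hf
  refine ⟨C, fun w => ?_⟩
  have hn : ∀ v w : Plane, ‖swapMap v - swapMap w‖ = ‖v - w‖ := by
    intro v w
    rw [EuclideanSpace.norm_eq, EuclideanSpace.norm_eq, Fin.sum_univ_two, Fin.sum_univ_two,
      add_comm]
    simp [swapMap]
  have hw : swapMap (swapMap w) = w := DFunLike.congr_fun swapMap_mul_self w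
  calc ‖(swapMap * f * swapMap) w - w‖
      = ‖swapMap (f (swapMap w)) - swapMap (swapMap w)‖ := by
        rw [hw]; rfl
    _ ≤ C := by rw [hn]; exact hC _

theorem skewMap_const_zero_bound (x : ℝ) : |(0 : C(ℝ, ℝ)) x| ≤ 0 := by simp

theorem exists_root_translateX : ∃ g, BoundedDisplacement g ∧ g ^ 2 = translateX (1 / 12) := by
  refine ⟨skewMap (Homeomorph.addRight (1 / 24)) 0, boundedDisplacement_skewMap (M := 1 / 24)
    (fun x => by simp [abs_of_pos]) skewMap_const_zero_bound, ?_⟩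
  rw [translateX_eq, skewMap_pow_zero]
  congr 1
  refine Homeomorph.ext fun x => ?_
  rw [addRight_pow_apply, Homeomorph.coe_addRight]
  norm_num

theorem exists_root_shear : ∃ g, BoundedDisplacement g ∧ g ^ 2 = shear (1 / 168) := by
  refine ⟨skewMap 1 ((1 / 336 : ℝ) • gamma0Map), boundedDisplacement_skewMap (M := 0) (N := 1)
    (fun x => by simp) (fun x => ?_), ?_⟩
  · have := abs_gamma0_le x
    rw [ContinuousMap.smul_apply, smul_eq_mul, abs_mul]
    change |1 / 336| * |gamma0 x| ≤ 1
    norm_num [abs_of_pos]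
    linarith
  · rw [shear_eq, skewMap_one_pow]
    congr 1
    ext x
    simp only [ContinuousMap.smul_apply]
    simp only [nsmul_eq_mul, smul_eq_mul]
    push_cast
    ring

theorem exists_root_deltaMap : ∃ g, BoundedDisplacement g ∧ g ^ 2 = deltaMap := by
  obtain ⟨σ, hσ, hb⟩ := exists_root_delta0
  exact ⟨skewMap σ 0, boundedDisplacement_skewMap hb skewMap_const_zero_bound,
    by rw [pow_two, skewMap_mul_zero, hσ, deltaMap_eq]⟩

theorem exists_root_swap_conj {f : Plane ≃ₜ Plane} (h : ∃ g, BoundedDisplacement g ∧ g ^ 2 = f) :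
    ∃ g, BoundedDisplacement g ∧ g ^ 2 = swapMap * f * swapMap := by
  obtain ⟨g, hg, rfl⟩ := h
  refine ⟨swapMap * g * swapMap, boundedDisplacement_swap_conj hg, ?_⟩
  rw [← conj_swapMap, ← conj_swapMap, map_pow]

theorem exists_root_planarGenerator (i : Fin 6) :
    ∃ g, BoundedDisplacement g ∧ g ^ 2 = planarGenerator i := by
  fin_cases i
  · exact exists_root_translateX
  · have := exists_root_swap_conj exists_root_translateX
    rwa [swapMap_translateX] at this
  · exact exists_root_shear
  · exact exists_root_deltaMap
  · exact exists_root_swap_conj exists_root_shear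
  · exact exists_root_swap_conj exists_root_deltaMap

theorem exists_root_diskGenerator (i : Fin 6) : ∃ g, g ^ 2 = diskGenerator i := by
  obtain ⟨g, hg, h⟩ := exists_root_planarGenerator i
  have hroot : (⟨g, hg⟩ : boundedHomeo) ^ 2 = boundedGenerator i :=
    Subtype.ext (by rw [Subgroup.coe_pow]; exact h)
  exact ⟨diskHom ⟨g, hg⟩, by rw [← map_pow, hroot, diskHom_boundedGenerator]⟩

theorem theorem2 :
    (∃ r : Fin 6 → homeoDiskRelBoundary, ∀ i, r i ^ 2 = diskGenerator i) ∧
      ∀ r : Fin 6 → homeoDiskRelBoundary, (∀ i, r i ^ 2 = diskGenerator i) →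
        (Subgroup.closure (Set.range r)).FG ∧
          ¬ ∃ ρ : Subgroup.closure (Set.range r) →* (Circle ≃ₜ Circle),
            Function.Injective ρ := by
  refine ⟨Classical.axiom_of_choice exists_root_diskGenerator, fun r hr => ⟨?_, ?_⟩⟩
  · exact (Subgroup.fg_iff _).mpr ⟨_, rfl, Set.finite_range r⟩
  · rintro ⟨ρ, hρ⟩
    set x : Fin 6 → Subgroup.closure (Set.range r) := fun i =>
      ⟨r i, Subgroup.subset_closure (Set.mem_range_self i)⟩
    have hx : ∀ i, (Subgroup.closure (Set.range r)).subtype (x i ^ 2) = diskGenerator i := hr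
    have h1 : KleinSystem (x 0 ^ 2) (x 2 ^ 2) (x 3 ^ 2) (x 1 ^ 2) := by
      refine KleinSystem.of_map (Subgroup.subtype _) Subtype.val_injective ?_
      rw [hx, hx, hx, hx]
      exact kleinSystem_diskGenerator
    have h2 : KleinSystem (x 1 ^ 2) (x 4 ^ 2) (x 5 ^ 2) (x 0 ^ 2) := by
      refine KleinSystem.of_map (Subgroup.subtype _) Subtype.val_injective ?_
      rw [hx, hx, hx, hx]
      exact kleinSystem_diskGenerator_swap
    -- The image of a generator is the square of the image of its root, hence preserves orientation
    -- whatever `ρ` is.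
    have hlift : ∀ i, ∃ F, IsLift F (ρ (x i ^ 2)) := fun i => by
      rw [map_pow]; exact exists_isLift_sq _
    choose F hF using hlift
    have h3 := pow_six_eq_one_of_kleinSystem (h1.map ρ) (h2.map ρ) (hF 0) (hF 2) (hF 3) (hF 1)
      (hF 4) (hF 5)
    rw [← map_pow, ← map_one ρ] at h3
    have h4 := congrArg (Subgroup.closure (Set.range r)).subtype (hρ h3)
    rw [map_pow, hx, map_one] at h4
    exact diskGenerator_zero_pow_six_ne_one h4
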